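/- Let $G=(V,E)$ be a finite connected graph with at least one edge (loops and multiple edges allowed). A metric on $G$ is a vector $g=(g_e)_{e\in E}$ of positive numbers; the edge $e$ is viewed as an interval of length $\ell_e=\sqrt{g_e}$, and $L(g)=\sum_{e\in E}\sqrt{g_e}$ is the total length. Let $0=\lambda_0(g)<\lambda_1(g)\le\lambda_2(g)\le\cdots$ be the eigenvalues, counted with multiplicity, of the problem: $-f''=\lambda f$ on every edge (derivatives with respect to arc length), $f$ is continuous on the graph, and at every vertex the sum of the outward derivatives of $f$ along all edge ends at that vertex is zero. A $\lambda$-eigenfunction is a nonzero solution $f$ of this problem. Put $\overline{\lambda_k}(g)=\lambda_k(g)L(g)^2$. A metric $g$ is called extremal for $\overline{\lambda_k}$ if for every smooth one-parameter family of metrics $g(t)$, defined for $t$ near $0$ with $g(0)=g$, one has, as $t\to0$, either $\overline{\lambda_k}(g(t))\le\overline{\lambda_k}(g)+o(t)$ or $\overline{\lambda_k}(g(t))\ge\overline{\lambda_k}(g)+o(t)$. Theorem. Let $k\ge 1$ and let $g$ be a metric on $G$. (1) If $g$ is extremal for $\overline{\lambda_k}$, then there exist finitely many $\lambda_k(g)$-eigenfunctions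 $f_1,\dots,f_n$ such that $$\sum_{i=1}^n\left(|\nabla_g f_i|_g^2+\lambda_k(g)f_i^2\right)=1\quad\text{at every point of every edge},\qquad(*)$$ where $|\nabla_g f|_g$ is the absolute value of the derivative of $f$ with respect to arc length. (2) Conversely, if there exist $\lambda_k(g)$-eigenfunctions $f_1,\dots,f_n$ satisfying $(*)$ and, additionally, $\lambda_k(g)>\lambda_{k-1}(g)$ or $\lambda_k(g)<\lambda_{k+1}(g)$, then $g$ is extremal for $\overline{\lambda_k}$. -/

import Mathlib

open Filter Topology Asymptotics
open scoped ContDiff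

/-- A graph with vertex set `V` and edge set `E`. Loops and multiple edges are allowed. Each edge
carries an (arbitrary) orientation, from `src e` to `tgt e`, which serves only to parametrise the
edge by the unit interval: the point `0` of the edge is `src e`, the point `1` is `tgt e`. -/
structure QuantumGraph (V E : Type*) where
  src : E → V
  tgt : E → V

namespace QuantumGraph

variable {V E : Type*}

/-- Any two vertices are joined by a path of edges, and there is at least one vertex. -/
def Connected (G : QuantumGraph V E) : Prop :=
  (SimpleGraph.fromRel fun u v => ∃ e, G.src e = u ∧ G.tgt e = v).Connected

/-- A metric on the graph is a vector of positive numbers `g e`; the edge `e` has the line element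
`g e * dx ^ 2` in its coordinate `x ∈ [0, 1]`, hence length `√(g e)`. -/
def IsMetric (g : E → ℝ) : Prop := ∀ e, 0 < g e

/-- The total length `L(g)`. -/
noncomputable def totalLength [Fintype E] (g : E → ℝ) : ℝ := ∑ e, √(g e)

/-- Real functions given edge by edge in the coordinate `x ∈ [0, 1]`. -/
abbrev EdgeFun (E : Type*) : Type _ := E → Set.Icc (0 : ℝ) 1 → ℝ

/-- The restriction of `f` to the edge `e`, extended constantly outside `[0, 1]` so that
derivatives within `[0, 1]` can be formed; the extension plays no other role. -/
noncomputable def onEdge (f : EdgeFun E) (e : E) : ℝ → ℝ := Set.IccExtend zero_le_one (f e)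

/-- The derivative `d f / d x` on the edge `e` (one-sided at the end points). -/
noncomputable def edgeDeriv (f : EdgeFun E) (e : E) (x : ℝ) : ℝ :=
  derivWithin (onEdge f e) (Set.Icc 0 1) x

/-- The Laplacian `Δ_g f = - (1 / g) * d² f / d x²` on the edge `e`. -/
noncomputable def laplacian (g : E → ℝ) (f : EdgeFun E) (e : E) (x : ℝ) : ℝ :=
  -(1 / g e * iteratedDerivWithin 2 (onEdge f e) (Set.Icc 0 1) x)

/-- The squared norm `|∇_g f|_g² = (1 / g) * (d f / d x)²` of the gradient on the edge `e`. -/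
noncomputable def gradNormSq (g : E → ℝ) (f : EdgeFun E) (e : E) (x : ℝ) : ℝ :=
  1 / g e * edgeDeriv f e x ^ 2

/-- The values of `f` at the ends of the edges fit together at the vertices. For a function that
is continuous on each closed edge this is continuity on the whole graph. -/
def MatchesAtVertices (G : QuantumGraph V E) (f : EdgeFun E) : Prop :=
  ∃ c : V → ℝ, ∀ e, f e 0 = c (G.src e) ∧ f e 1 = c (G.tgt e)

open Classical in
/-- The sum over all edge ends at `v` of the derivative of `f` at `v` with respect to arc length,
in the direction pointing out of `v` into the edge. A loop at `v` contributes both of its ends. -/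
noncomputable def outwardFlux [Fintype E] (G : QuantumGraph V E) (g : E → ℝ) (f : EdgeFun E)
    (v : V) : ℝ :=
  ∑ e, ((if G.src e = v then edgeDeriv f e 0 / √(g e) else 0) +
    (if G.tgt e = v then -edgeDeriv f e 1 / √(g e) else 0))

/-- `f` solves the eigenvalue problem with parameter `μ`: it is twice continuously differentiable
on every closed edge, `Δ_g f = μ f` on the edges, `f` is continuous on the graph, and the outward
derivatives sum to zero at every vertex. The zero function is allowed here. -/
structure Solves [Fintype E] (G : QuantumGraph V E) (g : E → ℝ) (μ : ℝ) (f : EdgeFun E) :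
    Prop where
  contDiffOn : ∀ e, ContDiffOn ℝ 2 (onEdge f e) (Set.Icc 0 1)
  laplacian_eq : ∀ e, ∀ x : Set.Icc (0 : ℝ) 1, laplacian g f e x = μ * f e x
  matches_vertices : G.MatchesAtVertices f
  flux_eq_zero : ∀ v, G.outwardFlux g f v = 0

theorem onEdge_add (f h : EdgeFun E) (e : E) : onEdge (f + h) e = onEdge f e + onEdge h e := rfl

theorem onEdge_smul (a : ℝ) (f : EdgeFun E) (e : E) : onEdge (a • f) e = a • onEdge f e := rfl

theorem edgeDeriv_add {f h : EdgeFun E} {e : E}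
    (hf : ContDiffOn ℝ 2 (onEdge f e) (Set.Icc 0 1))
    (hh : ContDiffOn ℝ 2 (onEdge h e) (Set.Icc 0 1)) {x : ℝ} (hx : x ∈ Set.Icc (0 : ℝ) 1) :
    edgeDeriv (f + h) e x = edgeDeriv f e x + edgeDeriv h e x := by
  unfold edgeDeriv
  rw [onEdge_add]
  exact derivWithin_add (hf.differentiableOn two_ne_zero x hx)
    (hh.differentiableOn two_ne_zero x hx)

theorem edgeDeriv_smul (a : ℝ) (f : EdgeFun E) (e : E) (x : ℝ) :
    edgeDeriv (a • f) e x = a * edgeDeriv f e x := by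
  unfold edgeDeriv
  rw [onEdge_smul, derivWithin_const_smul_field, smul_eq_mul]

theorem Solves.add [Fintype E] {G : QuantumGraph V E} {g : E → ℝ} {μ : ℝ} {f h : EdgeFun E}
    (hf : G.Solves g μ f) (hh : G.Solves g μ h) : G.Solves g μ (f + h) where
  contDiffOn e := by
    rw [onEdge_add]
    exact (hf.contDiffOn e).add (hh.contDiffOn e)
  laplacian_eq e x := by
    have h1 := hf.laplacian_eq e x
    have h2 := hh.laplacian_eq e x
    unfold laplacian at *
    rw [onEdge_add, iteratedDerivWithin_add x.2 (uniqueDiffOn_Icc zero_lt_one)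
      (hf.contDiffOn e x x.2) (hh.contDiffOn e x x.2)]
    simp only [Pi.add_apply]
    linarith
  matches_vertices := by
    obtain ⟨c, hc⟩ := hf.matches_vertices
    obtain ⟨d, hd⟩ := hh.matches_vertices
    exact ⟨c + d, fun e => by simp [(hc e).1, (hc e).2, (hd e).1, (hd e).2]⟩
  flux_eq_zero v := by
    have h1 : G.outwardFlux g f v + G.outwardFlux g h v = 0 := by
      rw [hf.flux_eq_zero v, hh.flux_eq_zero v, add_zero]
    refine Eq.trans ?_ h1
    unfold outwardFlux
    rw [← Finset.sum_add_distrib]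
    refine Finset.sum_congr rfl fun e _ => ?_
    rw [edgeDeriv_add (hf.contDiffOn e) (hh.contDiffOn e) (by simp),
      edgeDeriv_add (hf.contDiffOn e) (hh.contDiffOn e) (by simp)]
    split_ifs <;> ring

theorem Solves.smul [Fintype E] {G : QuantumGraph V E} {g : E → ℝ} {μ : ℝ} {f : EdgeFun E}
    (a : ℝ) (hf : G.Solves g μ f) : G.Solves g μ (a • f) where
  contDiffOn e := by
    rw [onEdge_smul]
    exact (hf.contDiffOn e).const_smul a
  laplacian_eq e x := by
    have h1 := hf.laplacian_eq e x
    unfold laplacian at *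
    rw [onEdge_smul, iteratedDerivWithin_const_smul x.2 (uniqueDiffOn_Icc zero_lt_one) a
      (hf.contDiffOn e x x.2)]
    simp only [Pi.smul_apply, smul_eq_mul]
    linear_combination a * h1
  matches_vertices := by
    obtain ⟨c, hc⟩ := hf.matches_vertices
    exact ⟨a • c, fun e => by simp [(hc e).1, (hc e).2]⟩
  flux_eq_zero v := by
    have h1 : a * G.outwardFlux g f v = 0 := by rw [hf.flux_eq_zero v, mul_zero]
    refine Eq.trans ?_ h1
    unfold outwardFlux
    rw [Finset.mul_sum]
    refine Finset.sum_congr rfl fun e _ => ?_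
    simp only [edgeDeriv_smul]
    split_ifs <;> ring

/-- The eigenspace `E(μ)`: all solutions of the eigenvalue problem with parameter `μ`. It is the
zero space exactly when `μ` is not an eigenvalue. -/
def eigenspace [Fintype E] (G : QuantumGraph V E) (g : E → ℝ) (μ : ℝ) :
    Submodule ℝ (EdgeFun E) where
  carrier := {f | G.Solves g μ f}
  add_mem' := Solves.add
  smul_mem' a _ := Solves.smul a
  zero_mem' :=
    { contDiffOn := fun _ => contDiffOn_const (c := (0 : ℝ))
      laplacian_eq := fun e x => by
        have h : onEdge (0 : EdgeFun E) e = fun _ => 0 := rfl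
        simp [laplacian, h]
      matches_vertices := ⟨0, fun _ => ⟨rfl, rfl⟩⟩
      flux_eq_zero := fun v => by
        have h : ∀ e, onEdge (0 : EdgeFun E) e = fun _ => 0 := fun _ => rfl
        simp [outwardFlux, edgeDeriv, h] }

/-- An eigenfunction with eigenvalue `μ`: a nonzero element of the eigenspace. -/
def IsEigenfunction [Fintype E] (G : QuantumGraph V E) (g : E → ℝ) (μ : ℝ) (f : EdgeFun E) :
    Prop :=
  f ∈ G.eigenspace g μ ∧ f ≠ 0

/-- The eigenvalue `λ_k(g)`, `k = 0, 1, 2, …`, in the increasing list of all eigenvalues repeated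
according to multiplicity: the least `x` such that `(-∞, x]` contains at least `k + 1` eigenvalues
counted with multiplicity. -/
noncomputable def eigenvalue [Fintype E] (G : QuantumGraph V E) (k : ℕ) (g : E → ℝ) : ℝ :=
  sInf {x : ℝ | ∃ s : Finset ℝ, (∀ μ ∈ s, μ ≤ x) ∧
    k + 1 ≤ ∑ μ ∈ s, Module.finrank ℝ (G.eigenspace g μ)}

/-- The normalised eigenvalue `λ_k(g) * L(g)²`. -/
noncomputable def normalizedEigenvalue [Fintype E] (G : QuantumGraph V E) (k : ℕ) (g : E → ℝ) :
    ℝ :=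
  G.eigenvalue k g * totalLength g ^ 2

/-- The metric `g` is extremal for the functional `F`: along every smooth one-parameter family of
metrics `γ t` with `γ 0 = g`, one has `F (γ t) ≤ F g + o(t)` or `F (γ t) ≥ F g + o(t)`
as `t → 0`. Which of the two holds may depend on the family. -/
def IsExtremal [Fintype E] (F : (E → ℝ) → ℝ) (g : E → ℝ) : Prop :=
  ∀ (ε : ℝ) (γ : ℝ → E → ℝ), 0 < ε → ContDiffOn ℝ ∞ γ (Set.Ioo (-ε) ε) →
    (∀ t ∈ Set.Ioo (-ε) ε, IsMetric (γ t)) → γ 0 = g →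
    (∃ r : ℝ → ℝ, r =o[𝓝 0] (fun t => t) ∧ ∀ᶠ t in 𝓝 0, F (γ t) ≤ F g + r t) ∨
    (∃ r : ℝ → ℝ, r =o[𝓝 0] (fun t => t) ∧ ∀ᶠ t in 𝓝 0, F g + r t ≤ F (γ t))

/-- There are finitely many `λ_k(g)`-eigenfunctions `f_1, …, f_n` with
`∑ (|∇_g f_i|_g² + λ_k(g) * f_i²) = 1` everywhere on the edges. -/
def HasUnitEnergyEigenfunctions [Fintype E] (G : QuantumGraph V E) (k : ℕ) (g : E → ℝ) : Prop :=
  ∃ (n : ℕ) (f : Fin n → EdgeFun E),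
    (∀ i, G.IsEigenfunction g (G.eigenvalue k g) (f i)) ∧
    ∀ (e : E) (x : Set.Icc (0 : ℝ) 1),
      ∑ i, (gradNormSq g (f i) e x + G.eigenvalue k g * f i e x ^ 2) = 1

end QuantumGraph

set_option linter.unusedSectionVars false

/-! On each edge `e` an eigenfunction `f` with eigenvalue `w²` has constant energy density `N_e(f) =
|∇f|² + w² f²`, and `N_e` measures how the eigenvalue reacts to a change of the length of `e`. Let
the lengths `ℓ_e` move with velocities `ℓ'_e`, and let `v_e = ℓ'_e - (∑ ℓ' / L) ℓ_e`, so that `∑ v_e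
= 0`. To first order the branches of the normalised eigenvalue are governed by the form `f ↦ -∑ v_e
N_e(f)` on the eigenspace.

If `∑_i N_e(f_i) = 1` for all `e`, then `∑_i ∑_e v_e N_e(f_i) = 0`. So in every direction some
branch does not rise and some branch does not fall. A gap below `λ_k` makes it the lowest branch, a
gap above makes it the highest, and a one-sided estimate follows for both signs of `t`. If no such
`f_i` exist, the constant vector 1 is separated from the compact convex hull of the normalised
vectors `(N_e(f))_e`. This gives `v` with `∑ v_e = 0` for which the form is definite: all branches
move the same way at a linear rate, so `λ_k` falls on one side of `t = 0` and rises on the other.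

Everything is done with finite matrices. Cut every edge into `p + 1` pieces shorter than half a
wavelength; a solution is then determined by its node values, and the kernel of the
Dirichlet-to-Neumann matrix `dtn` is the eigenspace (`finrank_eigenspace_eq`). Its sorted
eigenvalues strictly decrease in `w` (`strictAntiOn_piece`), so `λ_j` is the square of the zero of
the `j`-th one (`exists_eigenvalue_eq_sq`), and comparing `λ_j` with a number means finding the sign
of a quadratic form on a test space. `exists_hasDerivAt_dtn` differentiates this form and
`eventually_quadForm_neg` carries its sign to nearby metrics. -/

/-! ### Compactness of convex hulls. -/

open Module in
/-- In a finite-dimensional space the convex hull of a compact set is compact. -/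
theorem IsCompact.convexHull_of_finiteDimensional {F : Type*} [NormedAddCommGroup F]
    [NormedSpace ℝ F] [FiniteDimensional ℝ F] {s : Set F} (hs : IsCompact s) :
    IsCompact (convexHull ℝ s) := by
  classical
  rcases s.eq_empty_or_nonempty with rfl | ⟨x₀, hx₀⟩
  · simp
  set d := finrank ℝ F + 1 with hd
  have hK : IsCompact ((stdSimplex ℝ (Fin d)) ×ˢ (Set.univ.pi fun _ : Fin d => s)) :=
    (isCompact_stdSimplex ℝ (Fin d)).prod (isCompact_univ_pi fun _ => hs)
  have hc : Continuous fun q : (Fin d → ℝ) × (Fin d → F) => ∑ i, q.1 i • q.2 i := by fun_prop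
  convert hK.image hc using 1
  ext x
  constructor
  · intro hx
    -- Carathéodory: `finrank + 1` points suffice. Missing points are filled in by `x₀` with weight
    -- 0, so that the hull is a continuous image of one compact product.
    obtain ⟨ι, _, z, w, hz, hai, hw, hw1, hsum⟩ := eq_pos_convex_span_of_mem_convexHull hx
    have hcard : Fintype.card ι ≤ Fintype.card (Fin d) := by
      rw [Fintype.card_fin]
      exact hai.card_le_finrank_succ.trans
        (Nat.succ_le_succ (Submodule.finrank_le _))
    obtain ⟨φ⟩ := Function.Embedding.nonempty_of_card_le hcard
    have hext : ∀ {B : Type _} [AddCommMonoid B] (u : ι → B),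
        ∑ i, Function.extend φ u 0 i = ∑ i, u i := by
      intro B _ u
      rw [← Finset.sum_subset (Finset.subset_univ (Finset.univ.map φ)), Finset.sum_map]
      · simp [φ.injective.extend_apply]
      · intro i _ hi
        rw [Function.extend_apply']
        · rfl
        · rintro ⟨j, rfl⟩
          exact hi (by simp)
    refine ⟨(Function.extend φ w 0, Function.extend φ z fun _ => x₀), ⟨⟨?_, ?_⟩, ?_⟩, ?_⟩
    · intro i
      by_cases hi : ∃ j, φ j = i
      · obtain ⟨j, rfl⟩ := hi
        simp [φ.injective.extend_apply, (hw j).le]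
      · simp [Function.extend_apply' _ _ _ hi]
    · rw [← hw1, ← hext]
    · intro i _
      by_cases hi : ∃ j, φ j = i
      · obtain ⟨j, rfl⟩ := hi
        simpa [φ.injective.extend_apply] using hz ⟨j, rfl⟩
      · simpa [Function.extend_apply' _ _ _ hi] using hx₀
    · show ∑ i, Function.extend φ w 0 i • Function.extend φ z (fun _ => x₀) i = x
      rw [← hsum, ← Finset.sum_subset (Finset.subset_univ (Finset.univ.map φ)), Finset.sum_map]
      · simp [φ.injective.extend_apply]
      · intro i _ hi
        have : ¬ ∃ j, φ j = i := by
          rintro ⟨j, rfl⟩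
          exact hi (by simp)
        simp [Function.extend_apply' _ _ _ this]
  · rintro ⟨⟨w, z⟩, ⟨hw, hz⟩, rfl⟩
    exact (convex_convexHull ℝ s).sum_mem (fun i _ => hw.1 i) hw.2
      fun i _ => subset_convexHull ℝ s (hz i trivial)

/-! ### Sorted eigenvalues of symmetric matrices: min-max and perturbation. -/

section MatrixEigenvalues

open Module (finrank)

namespace Matrix

variable {n : Type*} [Fintype n]

/-- The quadratic form of a matrix. -/
def quadForm (M : Matrix n n ℝ) (c : n → ℝ) : ℝ := c ⬝ᵥ M *ᵥ c

theorem IsHermitian.exists_sorted_diagonalization {M : Matrix n n ℝ} (hM : M.IsHermitian) :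
    ∃ (m : Fin (Fintype.card n) → ℝ) (U : (n → ℝ) ≃ₗ[ℝ] (Fin (Fintype.card n) → ℝ)),
      Monotone m ∧ (∀ c i, U (M *ᵥ c) i = m i * U c i) ∧
        ∀ c d, c ⬝ᵥ d = ∑ i, U c i * U d i := by
  classical
  -- `eigenvalues₀` is decreasing, so the indices are reversed.
  let e : n ≃ Fin (Fintype.card n) :=
    (Fintype.equivOfCardEq (Fintype.card_fin _)).symm.trans Fin.revPerm
  let b := hM.eigenvectorBasis.reindex e
  have hb : ∀ i (c : n → ℝ), b.repr (WithLp.toLp 2 c) i = (b i).ofLp ⬝ᵥ c := by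
    intro i c
    rw [b.repr_apply_apply, EuclideanSpace.inner_eq_star_dotProduct, dotProduct_comm]
    rfl
  let U : (n → ℝ) ≃ₗ[ℝ] (Fin (Fintype.card n) → ℝ) :=
    (WithLp.linearEquiv 2 ℝ (n → ℝ)).symm.trans
      (b.repr.toLinearEquiv.trans (WithLp.linearEquiv 2 ℝ _))
  have hU : ∀ c i, U c i = (b i).ofLp ⬝ᵥ c := fun c i => hb i c
  refine ⟨fun i => hM.eigenvalues₀ i.rev, U, ?_, ?_, ?_⟩
  · intro i j hij
    exact hM.eigenvalues₀_antitone (Fin.rev_le_rev.mpr hij)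
  · intro c i
    have hb' : (b i).ofLp = (hM.eigenvectorBasis (e.symm i)).ofLp := by simp [b]
    have hev : hM.eigenvalues (e.symm i) = hM.eigenvalues₀ i.rev := by
      simp [IsHermitian.eigenvalues, e]
    rw [hU, hU, dotProduct_mulVec, ← mulVec_transpose,
      show M.transpose = M from hM, hb', hM.mulVec_eigenvectorBasis, smul_dotProduct, hev,
      smul_eq_mul]
  · intro c d
    have := b.sum_inner_mul_inner (WithLp.toLp 2 c) (WithLp.toLp 2 d)
    rw [EuclideanSpace.inner_eq_star_dotProduct] at this
    simp only [star_trivial] at this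
    rw [dotProduct_comm, ← this]
    refine Finset.sum_congr rfl fun i _ => ?_
    rw [hU, hU, EuclideanSpace.inner_eq_star_dotProduct, EuclideanSpace.inner_eq_star_dotProduct]
    simp only [star_trivial]
    rw [dotProduct_comm d]

/-- The eigenvalues of a real symmetric matrix in increasing order. -/
noncomputable def IsHermitian.sortedEig {M : Matrix n n ℝ} (hM : M.IsHermitian) :
    Fin (Fintype.card n) → ℝ :=
  hM.exists_sorted_diagonalization.choose

/-- Coordinates with respect to an orthonormal basis of eigenvectors, in the order of
`sortedEig`. -/
noncomputable def IsHermitian.eigCoord {M : Matrix n n ℝ} (hM : M.IsHermitian) :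
    (n → ℝ) ≃ₗ[ℝ] (Fin (Fintype.card n) → ℝ) :=
  hM.exists_sorted_diagonalization.choose_spec.choose

namespace IsHermitian

variable {M M' : Matrix n n ℝ} (hM : M.IsHermitian) (hM' : M'.IsHermitian)

theorem sortedEig_monotone : Monotone hM.sortedEig :=
  hM.exists_sorted_diagonalization.choose_spec.choose_spec.1

theorem eigCoord_mulVec (c : n → ℝ) (i) :
    hM.eigCoord (M *ᵥ c) i = hM.sortedEig i * hM.eigCoord c i :=
  hM.exists_sorted_diagonalization.choose_spec.choose_spec.2.1 c i

theorem dotProduct_eq_sum_eigCoord (c d : n → ℝ) :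
    c ⬝ᵥ d = ∑ i, hM.eigCoord c i * hM.eigCoord d i :=
  hM.exists_sorted_diagonalization.choose_spec.choose_spec.2.2 c d

theorem quadForm_eq_sum (c : n → ℝ) :
    M.quadForm c = ∑ i, hM.sortedEig i * hM.eigCoord c i ^ 2 := by
  rw [quadForm, hM.dotProduct_eq_sum_eigCoord]
  refine Finset.sum_congr rfl fun i _ => ?_
  rw [hM.eigCoord_mulVec]
  ring

theorem dotProduct_self_eq_sum (c : n → ℝ) : c ⬝ᵥ c = ∑ i, hM.eigCoord c i ^ 2 := by
  rw [hM.dotProduct_eq_sum_eigCoord]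
  exact Finset.sum_congr rfl fun i _ => by ring

/-- The span of the eigenvectors whose index lies in `s`. -/
noncomputable def eigSpan (s : Set (Fin (Fintype.card n))) : Submodule ℝ (n → ℝ) :=
  (⨅ i ∈ sᶜ, LinearMap.ker (LinearMap.proj i : (Fin (Fintype.card n) → ℝ) →ₗ[ℝ] ℝ)).comap
    hM.eigCoord.toLinearMap

theorem mem_eigSpan {s : Set (Fin (Fintype.card n))} {c : n → ℝ} :
    c ∈ hM.eigSpan s ↔ ∀ i, i ∉ s → hM.eigCoord c i = 0 := by
  simp [eigSpan]

theorem finrank_eigSpan (s : Set (Fin (Fintype.card n))) :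
    finrank ℝ (hM.eigSpan s) = s.ncard := by
  classical
  have h1 : finrank ℝ (hM.eigSpan s) = finrank ℝ ((⨅ i ∈ sᶜ, LinearMap.ker
      (LinearMap.proj i : (Fin (Fintype.card n) → ℝ) →ₗ[ℝ] ℝ)) : Submodule ℝ _) := by
    have : hM.eigSpan s = (⨅ i ∈ sᶜ, LinearMap.ker (LinearMap.proj i :
        (Fin (Fintype.card n) → ℝ) →ₗ[ℝ] ℝ)).map hM.eigCoord.symm.toLinearMap :=
      (Submodule.map_equiv_eq_comap_symm hM.eigCoord.symm _).symm
    rw [this]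
    exact LinearEquiv.finrank_map_eq hM.eigCoord.symm _
  rw [h1, (LinearMap.iInfKerProjEquiv ℝ (fun _ : Fin (Fintype.card n) => ℝ)
    (disjoint_compl_right (a := s)) (by simp)).finrank_eq]
  rw [Module.finrank_fintype_fun_eq_card, Set.ncard_eq_toFinset_card', Set.toFinset_card]

/-- Span of the eigenvectors with index at most `i`. -/
noncomputable def lowSpan (i : Fin (Fintype.card n)) : Submodule ℝ (n → ℝ) := hM.eigSpan (Set.Iic i)

/-- Span of the eigenvectors with index at least `i`. -/
noncomputable def highSpan (i : Fin (Fintype.card n)) : Submodule ℝ (n → ℝ) := hM.eigSpan (Set.Ici i)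

theorem finrank_lowSpan (i : Fin (Fintype.card n)) : finrank ℝ (hM.lowSpan i) = i + 1 := by
  rw [lowSpan, finrank_eigSpan, Set.ncard_eq_toFinset_card']
  simp

theorem finrank_highSpan (i : Fin (Fintype.card n)) :
    finrank ℝ (hM.highSpan i) = Fintype.card n - i := by
  rw [highSpan, finrank_eigSpan, Set.ncard_eq_toFinset_card']
  simp

theorem quadForm_le_of_mem_lowSpan {i : Fin (Fintype.card n)} {c : n → ℝ}
    (hc : c ∈ hM.lowSpan i) : M.quadForm c ≤ hM.sortedEig i * (c ⬝ᵥ c) := by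
  rw [hM.quadForm_eq_sum, hM.dotProduct_self_eq_sum, Finset.mul_sum]
  refine Finset.sum_le_sum fun l _ => ?_
  by_cases hl : l ≤ i
  · exact mul_le_mul_of_nonneg_right (hM.sortedEig_monotone hl) (sq_nonneg _)
  · simp [hM.mem_eigSpan.1 hc l hl]

theorem le_quadForm_of_mem_highSpan {i : Fin (Fintype.card n)} {c : n → ℝ}
    (hc : c ∈ hM.highSpan i) : hM.sortedEig i * (c ⬝ᵥ c) ≤ M.quadForm c := by
  rw [hM.quadForm_eq_sum, hM.dotProduct_self_eq_sum, Finset.mul_sum]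
  refine Finset.sum_le_sum fun l _ => ?_
  by_cases hl : i ≤ l
  · exact mul_le_mul_of_nonneg_right (hM.sortedEig_monotone hl) (sq_nonneg _)
  · simp [hM.mem_eigSpan.1 hc l hl]

theorem mulVec_eq_zero_iff (c : n → ℝ) :
    M *ᵥ c = 0 ↔ ∀ i, hM.sortedEig i * hM.eigCoord c i = 0 := by
  rw [← hM.eigCoord.map_eq_zero_iff, funext_iff]
  simp only [hM.eigCoord_mulVec, Pi.zero_apply]

/-- In eigencoordinates the form is a sum of nonpositive terms, so each term vanishes. This is what
turns null vectors of the form on a test space into eigenfunctions. -/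
theorem mulVec_eq_zero_of_mem_lowSpan {i : Fin (Fintype.card n)} (hi : hM.sortedEig i ≤ 0)
    {c : n → ℝ} (hc : c ∈ hM.lowSpan i) (h0 : M.quadForm c = 0) : M *ᵥ c = 0 := by
  have hle : ∀ l, hM.sortedEig l * hM.eigCoord c l ^ 2 ≤ 0 := by
    intro l
    by_cases hl : l ≤ i
    · exact mul_nonpos_of_nonpos_of_nonneg ((hM.sortedEig_monotone hl).trans hi) (sq_nonneg _)
    · simp [hM.mem_eigSpan.1 hc l hl]
  rw [hM.quadForm_eq_sum, Finset.sum_eq_zero_iff_of_nonpos fun l _ => hle l] at h0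
  rw [hM.mulVec_eq_zero_iff]
  intro l
  simpa using h0 l (Finset.mem_univ l)

theorem mulVec_eq_zero_of_mem_highSpan {i : Fin (Fintype.card n)} (hi : 0 ≤ hM.sortedEig i)
    {c : n → ℝ} (hc : c ∈ hM.highSpan i) (h0 : M.quadForm c = 0) : M *ᵥ c = 0 := by
  have hle : ∀ l, 0 ≤ hM.sortedEig l * hM.eigCoord c l ^ 2 := by
    intro l
    by_cases hl : i ≤ l
    · exact mul_nonneg (hi.trans (hM.sortedEig_monotone hl)) (sq_nonneg _)
    · simp [hM.mem_eigSpan.1 hc l hl]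
  rw [hM.quadForm_eq_sum, Finset.sum_eq_zero_iff_of_nonneg fun l _ => hle l] at h0
  rw [hM.mulVec_eq_zero_iff]
  intro l
  simpa using h0 l (Finset.mem_univ l)

theorem finrank_ker_mulVecLin :
    finrank ℝ (LinearMap.ker M.mulVecLin) = {i | hM.sortedEig i = 0}.ncard := by
  rw [← hM.finrank_eigSpan]
  suffices h : LinearMap.ker M.mulVecLin = hM.eigSpan {i | hM.sortedEig i = 0} by rw [h]
  ext c
  rw [LinearMap.mem_ker, mulVecLin_apply, hM.mulVec_eq_zero_iff, hM.mem_eigSpan]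
  simp only [mul_eq_zero, Set.mem_ofPred_eq]
  exact forall_congr' fun i => by tauto

end IsHermitian

theorem exists_ne_zero_mem_of_card_lt {S T : Submodule ℝ (n → ℝ)}
    (h : Fintype.card n < finrank ℝ S + finrank ℝ T) : ∃ c ≠ 0, c ∈ S ∧ c ∈ T := by
  have h1 := Submodule.finrank_sup_add_finrank_inf_eq S T
  have h2 : finrank ℝ ↥(S ⊔ T) ≤ Fintype.card n := by
    simpa using Submodule.finrank_le (S ⊔ T)
  have h3 : S ⊓ T ≠ ⊥ := by
    intro h0
    rw [h0, finrank_bot] at h1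
    omega
  obtain ⟨c, hc, hc0⟩ := Submodule.exists_mem_ne_zero_of_ne_bot h3
  exact ⟨c, hc0, hc.1, hc.2⟩

theorem dotProduct_self_pos {c : n → ℝ} (hc : c ≠ 0) : 0 < c ⬝ᵥ c :=
  lt_of_le_of_ne (Finset.sum_nonneg fun i _ => mul_self_nonneg (c i))
    fun h => hc (dotProduct_self_eq_zero.1 h.symm)

namespace IsHermitian

variable {M M' : Matrix n n ℝ} (hM : M.IsHermitian) (hM' : M'.IsHermitian)

/-- Min-max: by counting dimensions, `S` meets the span of the eigenvectors of index at least `i`,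
where the form is at least `sortedEig i` times the squared norm. The next lemmas are the variants of
this argument. -/
theorem sortedEig_le {i : Fin (Fintype.card n)} {x : ℝ} {S : Submodule ℝ (n → ℝ)}
    (hS : i + 1 ≤ finrank ℝ S) (h : ∀ c ∈ S, M.quadForm c ≤ x * (c ⬝ᵥ c)) :
    hM.sortedEig i ≤ x := by
  obtain ⟨c, hc0, hcS, hcT⟩ := exists_ne_zero_mem_of_card_lt (S := S) (T := hM.highSpan i)
    (by rw [finrank_highSpan]; omega)
  exact le_of_mul_le_mul_right ((hM.le_quadForm_of_mem_highSpan hcT).trans (h c hcS))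
    (dotProduct_self_pos hc0)

theorem le_sortedEig {i : Fin (Fintype.card n)} {x : ℝ} {S : Submodule ℝ (n → ℝ)}
    (hS : Fintype.card n - i ≤ finrank ℝ S) (h : ∀ c ∈ S, x * (c ⬝ᵥ c) ≤ M.quadForm c) :
    x ≤ hM.sortedEig i := by
  obtain ⟨c, hc0, hcS, hcT⟩ := exists_ne_zero_mem_of_card_lt (S := S) (T := hM.lowSpan i)
    (by rw [finrank_lowSpan]; omega)
  exact le_of_mul_le_mul_right ((h c hcS).trans (hM.quadForm_le_of_mem_lowSpan hcT))
    (dotProduct_self_pos hc0)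

theorem sortedEig_neg {i : Fin (Fintype.card n)} {S : Submodule ℝ (n → ℝ)}
    (hS : i + 1 ≤ finrank ℝ S) (h : ∀ c ∈ S, c ≠ 0 → M.quadForm c < 0) :
    hM.sortedEig i < 0 := by
  obtain ⟨c, hc0, hcS, hcT⟩ := exists_ne_zero_mem_of_card_lt (S := S) (T := hM.highSpan i)
    (by rw [finrank_highSpan]; omega)
  exact neg_of_mul_neg_left ((hM.le_quadForm_of_mem_highSpan hcT).trans_lt (h c hcS hc0))
    (dotProduct_self_pos hc0).le

theorem sortedEig_pos {i : Fin (Fintype.card n)} {S : Submodule ℝ (n → ℝ)}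
    (hS : Fintype.card n - i ≤ finrank ℝ S) (h : ∀ c ∈ S, c ≠ 0 → 0 < M.quadForm c) :
    0 < hM.sortedEig i := by
  obtain ⟨c, hc0, hcS, hcT⟩ := exists_ne_zero_mem_of_card_lt (S := S) (T := hM.lowSpan i)
    (by rw [finrank_lowSpan]; omega)
  exact pos_of_mul_pos_left ((h c hcS hc0).trans_le (hM.quadForm_le_of_mem_lowSpan hcT))
    (dotProduct_self_pos hc0).le

theorem sortedEig_le_add {ε : ℝ} (h : ∀ c, M.quadForm c ≤ M'.quadForm c + ε * (c ⬝ᵥ c))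
    (i : Fin (Fintype.card n)) : hM.sortedEig i ≤ hM'.sortedEig i + ε :=
  hM.sortedEig_le (hM'.finrank_lowSpan i).ge fun c hc => by
    rw [add_mul]
    exact (h c).trans (add_le_add (hM'.quadForm_le_of_mem_lowSpan hc) le_rfl)

theorem sortedEig_lt (h : ∀ c, c ≠ 0 → M.quadForm c < M'.quadForm c)
    (i : Fin (Fintype.card n)) : hM.sortedEig i < hM'.sortedEig i := by
  obtain ⟨c, hc0, hcS, hcT⟩ :=
    exists_ne_zero_mem_of_card_lt (S := hM'.lowSpan i) (T := hM.highSpan i)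
      (by rw [finrank_highSpan, finrank_lowSpan]; omega)
  exact lt_of_mul_lt_mul_right ((hM.le_quadForm_of_mem_highSpan hcT).trans_lt
    ((h c hc0).trans_le (hM'.quadForm_le_of_mem_lowSpan hcS))) (dotProduct_self_pos hc0).le

end IsHermitian

theorem quadForm_add_of_mulVec_eq_zero {M : Matrix n n ℝ} (hM : M.IsHermitian) {u f : n → ℝ}
    (hf : M *ᵥ f = 0) : M.quadForm (u + f) = M.quadForm u := by
  have : f ⬝ᵥ M *ᵥ u = 0 := by
    rw [dotProduct_mulVec, ← mulVec_transpose, show M.transpose = M from hM, hf,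
      zero_dotProduct]
  rw [quadForm, quadForm, mulVec_add, hf, add_zero, add_dotProduct, this, add_zero]

theorem abs_quadForm_le (M : Matrix n n ℝ) (c : n → ℝ) :
    |M.quadForm c| ≤ (∑ i, ∑ j, |M i j|) * (c ⬝ᵥ c) := by
  have hle : ∀ i, c i ^ 2 ≤ c ⬝ᵥ c := fun i => by
    rw [pow_two]
    exact Finset.single_le_sum (f := fun i => c i * c i) (fun j _ => mul_self_nonneg (c j))
      (Finset.mem_univ i)
  have h1 : M.quadForm c = ∑ i, ∑ j, M i j * (c i * c j) := by
    simp only [quadForm, dotProduct, mulVec, Finset.mul_sum]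
    exact Finset.sum_congr rfl fun i _ => Finset.sum_congr rfl fun j _ => by ring
  rw [h1, Finset.sum_mul]
  refine (Finset.abs_sum_le_sum_abs _ _).trans (Finset.sum_le_sum fun i _ => ?_)
  rw [Finset.sum_mul]
  refine (Finset.abs_sum_le_sum_abs _ _).trans (Finset.sum_le_sum fun j _ => ?_)
  rw [abs_mul]
  refine mul_le_mul_of_nonneg_left ?_ (abs_nonneg _)
  have := hle i
  have := hle j
  rw [abs_le]
  constructor <;> nlinarith [sq_nonneg (c i + c j), sq_nonneg (c i - c j)]

theorem quadForm_sub (M M' : Matrix n n ℝ) (c : n → ℝ) :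
    (M - M').quadForm c = M.quadForm c - M'.quadForm c := by
  rw [quadForm, sub_mulVec, dotProduct_sub]
  rfl

/-- Weyl's inequality: each sorted eigenvalue moves by at most the sum of the absolute values of the
entries of the difference. -/
theorem continuousOn_sortedEig {A : ℝ → Matrix n n ℝ} (hA : ∀ w, (A w).IsHermitian) {s : Set ℝ}
    (hc : ∀ i j, ContinuousOn (fun w => A w i j) s) (i : Fin (Fintype.card n)) :
    ContinuousOn (fun w => (hA w).sortedEig i) s := by
  intro w₀ hw₀
  have hlim : Tendsto (fun w => ∑ i, ∑ j, |(A w - A w₀) i j|) (𝓝[s] w₀) (𝓝 0) := by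
    have : ContinuousWithinAt (fun w => ∑ i, ∑ j, |(A w - A w₀) i j|) s w₀ := by
      refine tendsto_finsetSum _ fun i _ => tendsto_finsetSum _ fun j _ => ?_
      exact (((hc i j) w₀ hw₀).sub continuousWithinAt_const).abs
    have h0 := this.tendsto
    simpa using h0
  rw [ContinuousWithinAt, tendsto_iff_dist_tendsto_zero]
  refine squeeze_zero (fun _ => dist_nonneg) (fun w => ?_) hlim
  have hb := fun c => abs_le.1 ((abs_quadForm_le (A w - A w₀) c))
  simp only [quadForm_sub] at hb
  rw [Real.dist_eq, abs_le]
  constructor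
  · have := (hA w₀).sortedEig_le_add (hA w) (ε := ∑ i, ∑ j, |(A w - A w₀) i j|)
      (fun c => by linarith [(hb c).1]) i
    linarith
  · have := (hA w).sortedEig_le_add (hA w₀) (ε := ∑ i, ∑ j, |(A w - A w₀) i j|)
      (fun c => by linarith [(hb c).2]) i
    linarith

/-- First-order perturbation: if `Φ t₀` is nonpositive on a subspace and the derivative of `Φ` is
negative on its null vectors there, then `Φ t` is negative definite on the subspace for `t` slightly
larger than `0`. -/
theorem eventually_quadForm_neg {Φ : ℝ → Matrix n n ℝ} {D : Matrix n n ℝ}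
    (hD : ∀ i j, HasDerivAt (fun t => Φ t i j) (D i j) 0) {S : Submodule ℝ (n → ℝ)}
    (hS : ∀ c ∈ S, c ≠ 0 → (Φ 0).quadForm c ≤ 0)
    (hS' : ∀ c ∈ S, c ≠ 0 → (Φ 0).quadForm c = 0 → D.quadForm c < 0) :
    ∀ᶠ t in 𝓝[>] 0, ∀ c ∈ S, c ≠ 0 → (Φ t).quadForm c < 0 := by
  -- The difference quotient, completed by the derivative at 0, gives `Φ t = Φ 0 + t Δ t` with `Δ`
  -- continuous at 0.
  let Δ : ℝ → Matrix n n ℝ := fun t i j => dslope (fun t => Φ t i j) 0 t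
  have hΔ0 : Δ 0 = D := by
    ext i j
    simp [Δ, dslope_same, (hD i j).deriv]
  have hΔ : ∀ t, Φ t = Φ 0 + t • Δ t := by
    intro t
    ext i j
    have := sub_smul_dslope (fun t => Φ t i j) 0 t
    simp only [sub_zero, smul_eq_mul] at this
    show Φ t i j = Φ 0 i j + t * dslope (fun t => Φ t i j) 0 t
    rw [this]
    ring
  have hΔc : ContinuousAt Δ 0 :=
    continuousAt_pi.2 fun i => continuousAt_pi.2 fun j =>
      continuousAt_dslope_same.2 (hD i j).differentiableAt
  have hΦc : ContinuousAt Φ 0 :=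
    continuousAt_pi.2 fun i => continuousAt_pi.2 fun j => (hD i j).continuousAt
  have hqc : Continuous fun q : Matrix n n ℝ × (n → ℝ) => q.1.quadForm q.2 := by
    unfold quadForm
    fun_prop
  have hqt : ∀ t c, (Φ t).quadForm c = (Φ 0).quadForm c + t * (Δ t).quadForm c := by
    intro t c
    conv_lhs => rw [hΔ t]
    rw [quadForm, add_mulVec, smul_mulVec, dotProduct_add, dotProduct_smul]
    rfl
  -- By homogeneity it suffices to treat the unit sphere of `S`; its compactness makes the bound on
  -- `t` uniform in `c`.
  have hK : IsCompact ((S : Set (n → ℝ)) ∩ Metric.sphere 0 1) :=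
    (isCompact_sphere 0 1).inter_left S.closed_of_finiteDimensional
  have hloc : ∀ c₀ ∈ (S : Set (n → ℝ)) ∩ Metric.sphere 0 1,
      ∀ᶠ z : ℝ × (n → ℝ) in 𝓝 (0, c₀), 0 < z.1 → z.2 ∈ S → z.2 ≠ 0 → (Φ z.1).quadForm z.2 < 0 := by
    rintro c₀ ⟨hc₀S, hc₀⟩
    have hc₀0 : c₀ ≠ 0 := by
      rintro rfl
      simp at hc₀
    -- Near a vector with strict sign continuity of `Φ` is enough. Near a null vector `Φ 0`
    -- contributes at most 0 and `t Δ t` is negative.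
    rcases (hS c₀ hc₀S hc₀0).lt_or_eq with hlt | heq
    · have hcont : ContinuousAt (fun z : ℝ × (n → ℝ) => (Φ z.1).quadForm z.2) (0, c₀) :=
        ContinuousAt.comp (x := ((0 : ℝ), c₀)) (f := fun z : ℝ × (n → ℝ) => (Φ z.1, z.2))
          hqc.continuousAt
          ((ContinuousAt.comp (x := ((0 : ℝ), c₀)) (f := Prod.fst) hΦc continuousAt_fst).prodMk
            continuousAt_snd)
      filter_upwards [hcont.eventually_lt continuousAt_const hlt] with z hz _ _ _ using hz
    · have hcont : ContinuousAt (fun z : ℝ × (n → ℝ) => (Δ z.1).quadForm z.2) (0, c₀) :=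
        ContinuousAt.comp (x := ((0 : ℝ), c₀)) (f := fun z : ℝ × (n → ℝ) => (Δ z.1, z.2))
          hqc.continuousAt
          ((ContinuousAt.comp (x := ((0 : ℝ), c₀)) (f := Prod.fst) hΔc continuousAt_fst).prodMk
            continuousAt_snd)
      have hlt : (Δ 0).quadForm c₀ < 0 := hΔ0 ▸ hS' c₀ hc₀S hc₀0 heq
      filter_upwards [hcont.eventually_lt continuousAt_const hlt] with z hz hz0 hzS hzne
      rw [hqt]
      exact add_neg_of_nonpos_of_neg (hS z.2 hzS hzne) (mul_neg_of_pos_of_neg hz0 hz)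
  have := hK.eventually_forall_of_forall_eventually
    (P := fun t c => 0 < t → c ∈ S → c ≠ 0 → (Φ t).quadForm c < 0) hloc
  filter_upwards [nhdsWithin_le_nhds this, self_mem_nhdsWithin] with t ht htpos c hc hc0
  have hn : ‖c‖ ≠ 0 := norm_ne_zero_iff.2 hc0
  have h1 := ht (‖c‖⁻¹ • c) ⟨S.smul_mem _ hc, by simp [norm_smul, hn]⟩ htpos
    (S.smul_mem _ hc) (smul_ne_zero (inv_ne_zero hn) hc0)
  rw [quadForm, mulVec_smul, smul_dotProduct, dotProduct_smul] at h1
  have h2 : 0 < ‖c‖⁻¹ := by positivity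
  simp only [smul_eq_mul] at h1
  exact neg_of_mul_neg_right (neg_of_mul_neg_right h1 h2.le) h2.le

end Matrix

end MatrixEigenvalues

/-! ### Solutions of `y'' = -θ² y`, including `θ = 0`. -/

namespace QuantumGraph

/-- The solution of `y'' = -θ² y` with `y 0 = 0` and `y' 0 = 1`. -/
noncomputable def sinSol (θ x : ℝ) : ℝ := x * Real.sinc (θ * x)

/-- The solution of `y'' = -θ² y` with `y 0 = a` and `y' 0 = b`. -/
noncomputable def wave (θ a b x : ℝ) : ℝ := a * Real.cos (θ * x) + b * sinSol θ x

/-- The derivative of `wave θ a b`. -/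
noncomputable def waveDeriv (θ a b x : ℝ) : ℝ := b * Real.cos (θ * x) - a * θ ^ 2 * sinSol θ x

theorem mul_sinSol (θ x : ℝ) : θ * sinSol θ x = Real.sin (θ * x) := by
  by_cases h : θ * x = 0
  · rcases mul_eq_zero.1 h with h | h <;> simp [sinSol, h]
  · rw [sinSol, Real.sinc_of_ne_zero h]
    have : θ ≠ 0 := left_ne_zero_of_mul h
    have : x ≠ 0 := right_ne_zero_of_mul h
    field_simp

theorem sinSol_of_ne_zero {θ : ℝ} (hθ : θ ≠ 0) (x : ℝ) : sinSol θ x = Real.sin (θ * x) / θ := by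
  rw [← mul_sinSol, mul_div_cancel_left₀ _ hθ]

theorem sinSol_zero_left (x : ℝ) : sinSol 0 x = x := by simp [sinSol]

theorem sinSol_zero_right (θ : ℝ) : sinSol θ 0 = 0 := by simp [sinSol]

theorem sinc_pos_of_lt_pi {x : ℝ} (h0 : 0 ≤ x) (hx : x < Real.pi) : 0 < Real.sinc x := by
  rcases h0.eq_or_lt with rfl | h
  · simp
  · rw [Real.sinc_of_ne_zero h.ne']
    exact div_pos (Real.sin_pos_of_pos_of_lt_pi h hx) h

theorem sinSol_pos {θ x : ℝ} (hθ : 0 ≤ θ) (hx : 0 < x) (h : θ * x < Real.pi) : 0 < sinSol θ x :=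
  mul_pos hx (sinc_pos_of_lt_pi (by positivity) h)

theorem hasDerivAt_sinSol (θ x : ℝ) : HasDerivAt (sinSol θ) (Real.cos (θ * x)) x := by
  rcases eq_or_ne θ 0 with rfl | hθ
  · have : sinSol 0 = fun x => x := funext sinSol_zero_left
    rw [this]
    simpa using hasDerivAt_id' x
  · have : sinSol θ = fun x => Real.sin (θ * x) / θ := funext (sinSol_of_ne_zero hθ)
    rw [this]
    have := (((hasDerivAt_id' x).const_mul θ).sin).div_const θ
    exact this.congr_deriv (by field_simp)

theorem hasDerivAt_cos_mul (θ x : ℝ) :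
    HasDerivAt (fun x => Real.cos (θ * x)) (-(θ ^ 2 * sinSol θ x)) x := by
  refine (((hasDerivAt_id' x).const_mul θ).cos).congr_deriv ?_
  rw [← mul_sinSol]
  ring

theorem cos_sq_add_sinSol_sq (θ x : ℝ) : Real.cos (θ * x) ^ 2 + θ ^ 2 * sinSol θ x ^ 2 = 1 := by
  have := Real.sin_sq_add_cos_sq (θ * x)
  rw [← mul_sinSol] at this
  linarith

theorem sinSol_add (θ x y : ℝ) :
    sinSol θ (x + y) = sinSol θ x * Real.cos (θ * y) + Real.cos (θ * x) * sinSol θ y := by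
  rcases eq_or_ne θ 0 with rfl | hθ
  · simp [sinSol_zero_left]
  · simp only [sinSol_of_ne_zero hθ, mul_add, Real.sin_add]
    field_simp

theorem cos_mul_add (θ x y : ℝ) :
    Real.cos (θ * (x + y)) =
      Real.cos (θ * x) * Real.cos (θ * y) - θ ^ 2 * sinSol θ x * sinSol θ y := by
  rw [mul_add, Real.cos_add, ← mul_sinSol, ← mul_sinSol]
  ring

@[simp] theorem wave_zero (θ a b : ℝ) : wave θ a b 0 = a := by simp [wave, sinSol_zero_right]

@[simp] theorem waveDeriv_zero (θ a b : ℝ) : waveDeriv θ a b 0 = b := by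
  simp [waveDeriv, sinSol_zero_right]

theorem hasDerivAt_wave (θ a b x : ℝ) : HasDerivAt (wave θ a b) (waveDeriv θ a b x) x := by
  refine (((hasDerivAt_cos_mul θ x).const_mul a).add
    ((hasDerivAt_sinSol θ x).const_mul b)).congr_deriv ?_
  rw [waveDeriv]
  ring

theorem hasDerivAt_waveDeriv (θ a b x : ℝ) :
    HasDerivAt (waveDeriv θ a b) (-(θ ^ 2 * wave θ a b x)) x := by
  refine (((hasDerivAt_cos_mul θ x).const_mul b).sub
    ((hasDerivAt_sinSol θ x).const_mul (a * θ ^ 2))).congr_deriv ?_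
  rw [wave]
  ring

/-- Restarting the solution at `x`: value and slope there serve as new initial data. This passes
from one piece of an edge to the next. -/
theorem wave_add (θ a b x y : ℝ) :
    wave θ a b (x + y) = wave θ a b x * Real.cos (θ * y) + waveDeriv θ a b x * sinSol θ y := by
  simp only [wave, waveDeriv, sinSol_add, cos_mul_add]
  ring

theorem waveDeriv_add (θ a b x y : ℝ) :
    waveDeriv θ a b (x + y) =
      waveDeriv θ a b x * Real.cos (θ * y) - θ ^ 2 * wave θ a b x * sinSol θ y := by
  simp only [wave, waveDeriv, sinSol_add, cos_mul_add]
  ring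

/-- Conservation of energy, the reason why the energy density of an eigenfunction is constant on
each edge. -/
theorem waveDeriv_sq_add (θ a b x : ℝ) :
    waveDeriv θ a b x ^ 2 + θ ^ 2 * wave θ a b x ^ 2 = b ^ 2 + θ ^ 2 * a ^ 2 := by
  have := cos_sq_add_sinSol_sq θ x
  simp only [wave, waveDeriv]
  linear_combination (b ^ 2 + θ ^ 2 * a ^ 2) * this

theorem contDiff_wave (θ a b : ℝ) : ContDiff ℝ 2 (wave θ a b) := by
  have hd : deriv (wave θ a b) = waveDeriv θ a b := funext fun x => (hasDerivAt_wave θ a b x).deriv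
  have hd' : deriv (waveDeriv θ a b) = fun x => -(θ ^ 2 * wave θ a b x) :=
    funext fun x => (hasDerivAt_waveDeriv θ a b x).deriv
  have h0 : Differentiable ℝ (wave θ a b) := fun x => (hasDerivAt_wave θ a b x).differentiableAt
  have h1 : Differentiable ℝ (waveDeriv θ a b) :=
    fun x => (hasDerivAt_waveDeriv θ a b x).differentiableAt
  have h2 : ContDiff ℝ 1 (waveDeriv θ a b) := by
    rw [contDiff_one_iff_deriv]
    refine ⟨h1, ?_⟩
    rw [hd']
    exact (h0.continuous.const_mul _).neg
  rw [show (2 : WithTop ℕ∞) = 1 + 1 by norm_num, contDiff_succ_iff_deriv]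
  exact ⟨h0, by simp, hd ▸ h2⟩

variable {V E : Type*}

/-! ### Solutions of the eigenvalue problem on single edges; Green's formula. -/

section EdgeFunctions

theorem uniqueDiffOn_unitInterval : UniqueDiffOn ℝ (Set.Icc (0 : ℝ) 1) :=
  uniqueDiffOn_Icc zero_lt_one

theorem onEdge_coe (f : EdgeFun E) (e : E) (x : Set.Icc (0 : ℝ) 1) : onEdge f e x = f e x :=
  Set.IccExtend_val _ _ _

theorem onEdge_zero (f : EdgeFun E) (e : E) : onEdge f e 0 = f e 0 :=
  onEdge_coe f e 0

theorem onEdge_one (f : EdgeFun E) (e : E) : onEdge f e 1 = f e 1 :=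
  onEdge_coe f e 1

variable {f : EdgeFun E} {e : E} {θ a b : ℝ}

theorem onEdge_eqOn_wave (hf : ∀ x, f e x = wave θ a b x) :
    Set.EqOn (onEdge f e) (wave θ a b) (Set.Icc 0 1) := fun x hx => by
  rw [onEdge_coe f e ⟨x, hx⟩, hf]

theorem edgeDeriv_eq_waveDeriv (hf : ∀ x, f e x = wave θ a b x) {x : ℝ}
    (hx : x ∈ Set.Icc (0 : ℝ) 1) : edgeDeriv f e x = waveDeriv θ a b x := by
  rw [edgeDeriv, derivWithin_congr (onEdge_eqOn_wave hf) (onEdge_eqOn_wave hf hx)]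
  exact (hasDerivAt_wave θ a b x).hasDerivWithinAt.derivWithin (uniqueDiffOn_unitInterval x hx)

theorem iteratedDerivWithin_two_onEdge (f : EdgeFun E) (e : E) (x : ℝ) :
    iteratedDerivWithin 2 (onEdge f e) (Set.Icc 0 1) x =
      derivWithin (edgeDeriv f e) (Set.Icc 0 1) x := by
  rw [iteratedDerivWithin_succ, iteratedDerivWithin_one]
  rfl

theorem iteratedDerivWithin_two_eq_wave (hf : ∀ x, f e x = wave θ a b x) {x : ℝ}
    (hx : x ∈ Set.Icc (0 : ℝ) 1) :
    iteratedDerivWithin 2 (onEdge f e) (Set.Icc 0 1) x = -(θ ^ 2 * wave θ a b x) := by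
  rw [iteratedDerivWithin_two_onEdge,
    derivWithin_congr (fun y hy => edgeDeriv_eq_waveDeriv hf hy) (edgeDeriv_eq_waveDeriv hf hx)]
  exact (hasDerivAt_waveDeriv θ a b x).hasDerivWithinAt.derivWithin
    (uniqueDiffOn_unitInterval x hx)

variable [Fintype E] {G : QuantumGraph V E} {g : E → ℝ} {μ : ℝ}

theorem Solves.hasDerivWithinAt_onEdge (hf : G.Solves g μ f) (e : E) {x : ℝ}
    (hx : x ∈ Set.Icc (0 : ℝ) 1) :
    HasDerivWithinAt (onEdge f e) (edgeDeriv f e x) (Set.Icc 0 1) x :=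
  ((hf.contDiffOn e).differentiableOn two_ne_zero x hx).hasDerivWithinAt

theorem Solves.hasDerivWithinAt_edgeDeriv (hf : G.Solves g μ f) (hg : IsMetric g) (e : E) {x : ℝ}
    (hx : x ∈ Set.Icc (0 : ℝ) 1) :
    HasDerivWithinAt (edgeDeriv f e) (-(μ * g e * onEdge f e x)) (Set.Icc 0 1) x := by
  have hd : DifferentiableOn ℝ (edgeDeriv f e) (Set.Icc 0 1) :=
    ((hf.contDiffOn e).derivWithin (m := 1) uniqueDiffOn_unitInterval
      (by norm_num)).differentiableOn one_ne_zero
  have h := (hd x hx).hasDerivWithinAt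
  rw [← iteratedDerivWithin_two_onEdge] at h
  have h2 := hf.laplacian_eq e ⟨x, hx⟩
  rw [← onEdge_coe f] at h2
  simp only [laplacian] at h2
  have h3 : iteratedDerivWithin 2 (onEdge f e) (Set.Icc 0 1) x = -(μ * g e * onEdge f e x) := by
    have := (hg e).ne'
    field_simp at h2
    linarith
  rwa [h3] at h

/-- Applying the inverse of the propagator to `(f, f')` gives two combinations with zero derivative,
hence equal to the initial data. Solving for `f` uses that the propagator has determinant 1. -/
theorem Solves.eq_wave (hf : G.Solves g μ f) (hg : IsMetric g) (e : E) (hθ : θ ^ 2 = μ * g e)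
    (x : Set.Icc (0 : ℝ) 1) : f e x = wave θ (f e 0) (edgeDeriv f e 0) x := by
  have key : ∀ (φ ψ φ' ψ' : ℝ → ℝ), (∀ y, HasDerivAt φ (φ' y) y) →
      (∀ y, HasDerivAt ψ (ψ' y) y) →
      (∀ y, φ' y * onEdge f e y + φ y * edgeDeriv f e y +
        (ψ' y * edgeDeriv f e y + ψ y * (-(μ * g e * onEdge f e y))) = 0) →
      φ x * onEdge f e x + ψ x * edgeDeriv f e x =
        φ 0 * onEdge f e 0 + ψ 0 * edgeDeriv f e 0 := by
    intro φ ψ φ' ψ' hφ hψ h0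
    have hd : ∀ y ∈ Set.Icc (0 : ℝ) 1, HasDerivWithinAt
        (fun y => φ y * onEdge f e y + ψ y * edgeDeriv f e y) 0 (Set.Icc 0 1) y := by
      intro y hy
      refine HasDerivWithinAt.congr_deriv ?_ (h0 y)
      exact ((hφ y).hasDerivWithinAt.mul (hf.hasDerivWithinAt_onEdge e hy)).add
        ((hψ y).hasDerivWithinAt.mul (hf.hasDerivWithinAt_edgeDeriv hg e hy))
    exact constant_of_derivWithin_zero (fun y hy => (hd y hy).differentiableWithinAt)
      (fun y hy => (hd y (Set.Ico_subset_Icc_self hy)).derivWithin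
        (uniqueDiffOn_unitInterval y (Set.Ico_subset_Icc_self hy))) x x.2
  have h1 := key (fun y => Real.cos (θ * y)) (fun y => -sinSol θ y) _ _ (hasDerivAt_cos_mul θ)
    (fun y => (hasDerivAt_sinSol θ y).neg) (fun y => by rw [hθ]; ring)
  have h2 := key (fun y => θ ^ 2 * sinSol θ y) (fun y => Real.cos (θ * y)) _ _
    (fun y => (hasDerivAt_sinSol θ y).const_mul (θ ^ 2))
    (hasDerivAt_cos_mul θ) (fun y => by rw [hθ]; ring)
  have h3 := cos_sq_add_sinSol_sq θ x
  simp only [mul_zero, sinSol_zero_right, Real.cos_zero, onEdge_zero, onEdge_coe] at h1 h2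
  rw [wave]
  linear_combination Real.cos (θ * x) * h1 + sinSol θ x * h2 - f e x * h3

/-- Green's formula, boundary terms. -/
theorem sum_boundary_eq_flux [Fintype V] (G : QuantumGraph V E) (g : E → ℝ) (f : EdgeFun E)
    {c : V → ℝ} (hc : ∀ e, f e 0 = c (G.src e) ∧ f e 1 = c (G.tgt e)) :
    ∑ e, (f e 1 * edgeDeriv f e 1 - f e 0 * edgeDeriv f e 0) / √(g e) =
      -∑ v, c v * G.outwardFlux g f v := by
  classical
  simp only [outwardFlux, Finset.mul_sum]
  rw [Finset.sum_comm, ← Finset.sum_neg_distrib]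
  refine Finset.sum_congr rfl fun e _ => ?_
  simp only [mul_add, mul_ite, mul_zero, Finset.sum_add_distrib, Finset.sum_ite_eq,
    Finset.mem_univ, if_true]
  rw [(hc e).1, (hc e).2]
  ring

/-- There are no negative eigenvalues. -/
theorem Solves.eq_zero_of_neg [Fintype V] (hf : G.Solves g μ f) (hg : IsMetric g) (hμ : μ < 0) :
    f = 0 := by
  obtain ⟨c, hc⟩ := hf.matches_vertices
  have hsum := sum_boundary_eq_flux G g f hc
  simp only [hf.flux_eq_zero, mul_zero, Finset.sum_const_zero, neg_zero] at hsum
  -- `(f f')' = f'² - μ g f²` is nonnegative for `μ < 0`, so `f f'` is monotone on every edge. By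
  -- the vertex conditions its weighted increments sum to zero, so it is constant and its derivative
  -- vanishes.
  let H : E → ℝ → ℝ := fun e x => onEdge f e x * edgeDeriv f e x
  have hd : ∀ e, ∀ x ∈ Set.Icc (0 : ℝ) 1, HasDerivWithinAt (H e)
      (edgeDeriv f e x ^ 2 + -μ * g e * onEdge f e x ^ 2) (Set.Icc 0 1) x := by
    intro e x hx
    exact ((hf.hasDerivWithinAt_onEdge e hx).mul
      (hf.hasDerivWithinAt_edgeDeriv hg e hx)).congr_deriv (by ring)
  have hnn : ∀ e x, 0 ≤ edgeDeriv f e x ^ 2 + -μ * g e * onEdge f e x ^ 2 := fun e x => by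
    have := hg e
    have : 0 < -μ := by linarith
    positivity
  have hmono : ∀ e, MonotoneOn (H e) (Set.Icc 0 1) := fun e => by
    refine monotoneOn_of_deriv_nonneg (convex_Icc 0 1)
      (fun x hx => (hd e x hx).continuousWithinAt) (fun x hx => ?_) (fun x hx => ?_)
    · exact ((hd e x (interior_subset hx)).mono interior_subset).differentiableWithinAt
    · rw [((hd e x (interior_subset hx)).hasDerivAt
        (mem_interior_iff_mem_nhds.1 hx)).deriv]
      exact hnn e x
  have h0 : (0 : ℝ) ∈ Set.Icc (0 : ℝ) 1 := by simp
  have h1 : (1 : ℝ) ∈ Set.Icc (0 : ℝ) 1 := by simp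
  have hnonneg : ∀ e ∈ Finset.univ,
      0 ≤ (f e 1 * edgeDeriv f e 1 - f e 0 * edgeDeriv f e 0) / √(g e) := fun e _ => by
    have := hmono e h0 h1 zero_le_one
    simp only [H, onEdge_zero, onEdge_one] at this
    exact div_nonneg (by linarith) (Real.sqrt_nonneg _)
  rw [Finset.sum_eq_zero_iff_of_nonneg hnonneg] at hsum
  funext e x
  have hH : H e 1 = H e 0 := by
    have := hsum e (Finset.mem_univ e)
    rw [div_eq_zero_iff, or_iff_left (Real.sqrt_pos.2 (hg e)).ne'] at this
    simp only [H, onEdge_zero, onEdge_one]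
    linarith
  have hconst : ∀ y ∈ Set.Icc (0 : ℝ) 1, H e y = H e 0 := fun y hy =>
    le_antisymm ((hmono e hy h1 hy.2).trans hH.le) (hmono e h0 hy hy.1)
  have hz : edgeDeriv f e x ^ 2 + -μ * g e * onEdge f e x ^ 2 = 0 := by
    have h2 := (hd e x x.2).derivWithin (uniqueDiffOn_unitInterval x x.2)
    rw [derivWithin_congr (f := fun _ => H e 0) hconst (hconst x x.2)] at h2
    simpa using h2.symm
  have h3 : 0 < -μ * g e := mul_pos (by linarith) (hg e)
  have h4 : onEdge f e x ^ 2 = 0 := by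
    have := sq_nonneg (edgeDeriv f e x)
    have := sq_nonneg (onEdge f e x)
    nlinarith
  rw [onEdge_coe] at h4
  simpa using h4

end EdgeFunctions

/-! ### Weighted vertex matrices and subdivided graphs. -/

section VertexMatrix

variable [Fintype E]

open Classical in
/-- The weighted vertex matrix with diagonal contribution `P e` at both ends of the edge `e` and
off-diagonal contribution `-Q e`. -/
noncomputable def vertexMatrix (G : QuantumGraph V E) (P Q : E → ℝ) : Matrix V V ℝ :=
  Matrix.of fun u v => ∑ e,
    ((if G.src e = u then
        P e * (if G.src e = v then 1 else 0) - Q e * (if G.tgt e = v then 1 else 0) else 0) +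
      (if G.tgt e = u then
        P e * (if G.tgt e = v then 1 else 0) - Q e * (if G.src e = v then 1 else 0) else 0))

theorem vertexMatrix_isHermitian (G : QuantumGraph V E) (P Q : E → ℝ) :
    (G.vertexMatrix P Q).IsHermitian := by
  refine Matrix.IsHermitian.ext fun u v => ?_
  simp only [vertexMatrix, Matrix.of_apply, star_trivial]
  refine Finset.sum_congr rfl fun e _ => ?_
  split_ifs <;> ring

open Classical in
theorem vertexMatrix_mulVec [Fintype V] (G : QuantumGraph V E) (P Q : E → ℝ) (c : V → ℝ) (v : V) :
    (G.vertexMatrix P Q).mulVec c v = ∑ e,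
      ((if G.src e = v then P e * c (G.src e) - Q e * c (G.tgt e) else 0) +
        (if G.tgt e = v then P e * c (G.tgt e) - Q e * c (G.src e) else 0)) := by
  simp only [vertexMatrix, Matrix.mulVec, dotProduct, Matrix.of_apply, Finset.sum_mul]
  rw [Finset.sum_comm]
  refine Finset.sum_congr rfl fun e _ => ?_
  split_ifs <;>
    simp [add_mul, sub_mul, Finset.sum_add_distrib, Finset.sum_sub_distrib]

theorem vertexMatrix_quadForm [Fintype V] (G : QuantumGraph V E) (P Q : E → ℝ) (c : V → ℝ) :
    (G.vertexMatrix P Q).quadForm c = ∑ e,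
      (P e * (c (G.src e) ^ 2 + c (G.tgt e) ^ 2) - 2 * Q e * c (G.src e) * c (G.tgt e)) := by
  classical
  simp only [Matrix.quadForm, dotProduct, vertexMatrix_mulVec, Finset.mul_sum]
  rw [Finset.sum_comm]
  refine Finset.sum_congr rfl fun e _ => ?_
  simp only [mul_add, mul_ite, mul_zero, Finset.sum_add_distrib, Finset.sum_ite_eq,
    Finset.mem_univ, if_true]
  ring

end VertexMatrix

section Subdivision

/-- Every edge is divided into `p + 1` pieces by `p` new vertices. -/
def subdivide (G : QuantumGraph V E) (p : ℕ) : QuantumGraph (V ⊕ E × Fin p) (E × Fin (p + 1)) where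
  src q := Fin.cases (Sum.inl (G.src q.1)) (fun i => Sum.inr (q.1, i)) q.2
  tgt q := Fin.lastCases (Sum.inl (G.tgt q.1)) (fun i => Sum.inr (q.1, i)) q.2

variable (G : QuantumGraph V E) {p : ℕ}

@[simp] theorem subdivide_src_zero (e : E) :
    (G.subdivide p).src (e, 0) = Sum.inl (G.src e) := rfl

@[simp] theorem subdivide_src_succ (e : E) (i : Fin p) :
    (G.subdivide p).src (e, i.succ) = Sum.inr (e, i) := rfl

@[simp] theorem subdivide_tgt_last (e : E) :
    (G.subdivide p).tgt (e, Fin.last p) = Sum.inl (G.tgt e) := by simp [subdivide]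

@[simp] theorem subdivide_tgt_castSucc (e : E) (i : Fin p) :
    (G.subdivide p).tgt (e, i.castSucc) = Sum.inr (e, i) := by simp [subdivide]

variable [Fintype E] [Fintype V]

/-- A new node is the source of exactly one piece and the target of exactly one piece, so only two
terms of the sum survive. -/
theorem subdivide_mulVec_inr (P Q : E × Fin (p + 1) → ℝ) (c : V ⊕ E × Fin p → ℝ) (e : E)
    (i : Fin p) :
    ((G.subdivide p).vertexMatrix P Q).mulVec c (Sum.inr (e, i)) =
      (P (e, i.succ) * c (Sum.inr (e, i)) -
          Q (e, i.succ) * c ((G.subdivide p).tgt (e, i.succ))) +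
        (P (e, i.castSucc) * c (Sum.inr (e, i)) -
          Q (e, i.castSucc) * c ((G.subdivide p).src (e, i.castSucc))) := by
  classical
  rw [vertexMatrix_mulVec, Finset.sum_add_distrib]
  congr 1
  · rw [Finset.sum_eq_single (e, i.succ)]
    · simp
    · rintro ⟨e', j⟩ _ hne
      rw [if_neg]
      induction j using Fin.cases with
      | zero => simp
      | succ j =>
        simp only [subdivide_src_succ, Sum.inr.injEq, Prod.mk.injEq, not_and]
        rintro rfl rfl
        exact hne rfl
    · simp
  · rw [Finset.sum_eq_single (e, i.castSucc)]
    · simp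
    · rintro ⟨e', j⟩ _ hne
      rw [if_neg]
      induction j using Fin.lastCases with
      | last => simp
      | cast j =>
        simp only [subdivide_tgt_castSucc, Sum.inr.injEq, Prod.mk.injEq, not_and]
        rintro rfl rfl
        exact hne rfl
    · simp

open Classical in
theorem subdivide_mulVec_inl (P Q : E × Fin (p + 1) → ℝ) (c : V ⊕ E × Fin p → ℝ) (v : V) :
    ((G.subdivide p).vertexMatrix P Q).mulVec c (Sum.inl v) =
      ∑ e, ((if G.src e = v then P (e, 0) * c (Sum.inl (G.src e)) -
          Q (e, 0) * c ((G.subdivide p).tgt (e, 0)) else 0) +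
        (if G.tgt e = v then P (e, Fin.last p) * c (Sum.inl (G.tgt e)) -
          Q (e, Fin.last p) * c ((G.subdivide p).src (e, Fin.last p)) else 0)) := by
  rw [vertexMatrix_mulVec, Fintype.sum_prod_type]
  refine Finset.sum_congr rfl fun e _ => ?_
  rw [Finset.sum_add_distrib]
  congr 1
  · rw [Fin.sum_univ_succ]
    simp
  · rw [Fin.sum_univ_castSucc]
    simp

end Subdivision

end QuantumGraph

/-! ### The Dirichlet-to-Neumann matrix and its kernel. -/

namespace QuantumGraph

/-- The length of a piece when the unit interval is divided into `p + 1` pieces. -/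
noncomputable def pieceLength (p : ℕ) : ℝ := 1 / (p + 1)

theorem pieceLength_pos (p : ℕ) : 0 < pieceLength p := by
  unfold pieceLength
  positivity

theorem succ_mul_pieceLength (p : ℕ) : ((p : ℝ) + 1) * pieceLength p = 1 := by
  unfold pieceLength
  field_simp

/-- Diagonal coefficient of the Dirichlet-to-Neumann form of a piece of an edge of length `ℓ` at
frequency `w`. -/
noncomputable def diagCoeff (p : ℕ) (w ℓ : ℝ) : ℝ :=
  Real.cos (w * ℓ * pieceLength p) / (ℓ * sinSol (w * ℓ) (pieceLength p))

/-- Off-diagonal coefficient of the Dirichlet-to-Neumann form of a piece of an edge of length `ℓ`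
at frequency `w`. -/
noncomputable def offCoeff (p : ℕ) (w ℓ : ℝ) : ℝ := 1 / (ℓ * sinSol (w * ℓ) (pieceLength p))

variable {V E : Type*} [Fintype V] [Fintype E]

/-- The Dirichlet-to-Neumann matrix at frequency `w` of the graph with all edges divided into
`p + 1` equal pieces. -/
noncomputable def dtn (G : QuantumGraph V E) (p : ℕ) (g : E → ℝ) (w : ℝ) :
    Matrix (V ⊕ E × Fin p) (V ⊕ E × Fin p) ℝ :=
  (G.subdivide p).vertexMatrix (fun q => diagCoeff p w √(g q.1)) (fun q => offCoeff p w √(g q.1))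

theorem dtn_isHermitian (G : QuantumGraph V E) (p : ℕ) (g : E → ℝ) (w : ℝ) :
    (G.dtn p g w).IsHermitian := vertexMatrix_isHermitian _ _ _

/-- The frequency `w` is below all Dirichlet frequencies of the pieces. -/
structure Admissible (p : ℕ) (g : E → ℝ) (w : ℝ) : Prop where
  isMetric : IsMetric g
  nonneg : 0 ≤ w
  lt_pi : ∀ e, w * √(g e) * pieceLength p < Real.pi

theorem Admissible.mono {p : ℕ} {g : E → ℝ} {w w' : ℝ} (h : Admissible p g w) (h0 : 0 ≤ w')
    (hle : w' ≤ w) : Admissible p g w' where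
  isMetric := h.isMetric
  nonneg := h0
  lt_pi e := lt_of_le_of_lt (by
    have := pieceLength_pos p
    gcongr) (h.lt_pi e)

theorem Admissible.sqrt_pos {p : ℕ} {g : E → ℝ} {w : ℝ} (h : Admissible p g w) (e : E) :
    0 < √(g e) := Real.sqrt_pos.2 (h.isMetric e)

theorem Admissible.sinSol_pos {p : ℕ} {g : E → ℝ} {w : ℝ} (h : Admissible p g w) (e : E) :
    0 < sinSol (w * √(g e)) (pieceLength p) :=
  QuantumGraph.sinSol_pos (mul_nonneg h.nonneg (Real.sqrt_nonneg _)) (pieceLength_pos p) (h.lt_pi e)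

variable {G : QuantumGraph V E} {p : ℕ} {g : E → ℝ} {w : ℝ}

/-- The node values `c` are the values of the waves with initial values `a` and slopes `b`. -/
def Samples (G : QuantumGraph V E) (p : ℕ) (θ a b : E → ℝ) (c : V ⊕ E × Fin p → ℝ) : Prop :=
  ∀ e (j : Fin (p + 1)),
    c ((G.subdivide p).src (e, j)) = wave (θ e) (a e) (b e) (j * pieceLength p) ∧
      c ((G.subdivide p).tgt (e, j)) =
        wave (θ e) (a e) (b e) (j * pieceLength p + pieceLength p)

section Samples

variable {a b : E → ℝ} {c : V ⊕ E × Fin p → ℝ}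

/-- The two coefficients convert the end values of a piece into minus the outward slope with respect
to arc length; `tgt_eq` does this at the other end. -/
theorem Samples.src_eq (hs : Samples G p (fun e => w * √(g e)) a b c) (h : Admissible p g w)
    (q : E × Fin (p + 1)) :
    diagCoeff p w √(g q.1) * c ((G.subdivide p).src q) -
        offCoeff p w √(g q.1) * c ((G.subdivide p).tgt q) =
      -waveDeriv (w * √(g q.1)) (a q.1) (b q.1) (q.2 * pieceLength p) / √(g q.1) := by
  have h1 := (h.sqrt_pos q.1).ne'
  have h2 := (h.sinSol_pos q.1).ne'
  rw [(hs q.1 q.2).1, (hs q.1 q.2).2, wave_add, diagCoeff, offCoeff]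
  field_simp
  ring

theorem Samples.tgt_eq (hs : Samples G p (fun e => w * √(g e)) a b c) (h : Admissible p g w)
    (q : E × Fin (p + 1)) :
    diagCoeff p w √(g q.1) * c ((G.subdivide p).tgt q) -
        offCoeff p w √(g q.1) * c ((G.subdivide p).src q) =
      waveDeriv (w * √(g q.1)) (a q.1) (b q.1) (q.2 * pieceLength p + pieceLength p) /
        √(g q.1) := by
  have h1 := (h.sqrt_pos q.1).ne'
  have h2 := (h.sinSol_pos q.1).ne'
  have h3 := cos_sq_add_sinSol_sq (w * √(g q.1)) (pieceLength p)
  rw [(hs q.1 q.2).1, (hs q.1 q.2).2, wave_add, waveDeriv_add, diagCoeff, offCoeff]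
  generalize wave (w * √(g q.1)) (a q.1) (b q.1) (q.2 * pieceLength p) = y
  generalize waveDeriv (w * √(g q.1)) (a q.1) (b q.1) (q.2 * pieceLength p) = z
  generalize Real.cos (w * √(g q.1) * pieceLength p) = C at *
  generalize sinSol (w * √(g q.1)) (pieceLength p) = S at *
  rw [div_mul_eq_mul_div, div_mul_eq_mul_div, ← sub_div, div_eq_div_iff (by positivity) h1]
  linear_combination √(g q.1) * y * h3

/-- The wave is differentiable across the node, so the slopes of the two adjacent pieces cancel. -/
theorem Samples.mulVec_inr (hs : Samples G p (fun e => w * √(g e)) a b c) (h : Admissible p g w)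
    (e : E) (i : Fin p) : (G.dtn p g w).mulVec c (Sum.inr (e, i)) = 0 := by
  have h1 := hs.src_eq h (e, i.succ)
  have h2 := hs.tgt_eq h (e, i.castSucc)
  rw [subdivide_src_succ] at h1
  rw [subdivide_tgt_castSucc] at h2
  rw [dtn, subdivide_mulVec_inr]
  simp only [h1, h2, Fin.val_succ, Fin.val_castSucc]
  push_cast
  ring_nf

open Classical in
theorem Samples.mulVec_inl (hs : Samples G p (fun e => w * √(g e)) a b c) (h : Admissible p g w)
    (v : V) : (G.dtn p g w).mulVec c (Sum.inl v) =
      ∑ e, ((if G.src e = v then -waveDeriv (w * √(g e)) (a e) (b e) 0 / √(g e) else 0) +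
        (if G.tgt e = v then waveDeriv (w * √(g e)) (a e) (b e) 1 / √(g e) else 0)) := by
  rw [dtn, subdivide_mulVec_inl]
  refine Finset.sum_congr rfl fun e _ => ?_
  have h1 := hs.src_eq h (e, 0)
  have h2 := hs.tgt_eq h (e, Fin.last p)
  rw [subdivide_src_zero] at h1
  rw [subdivide_tgt_last] at h2
  have h3 : (p : ℝ) * pieceLength p + pieceLength p = 1 := by
    rw [← succ_mul_pieceLength p]
    ring
  simp only [h1, h2, Fin.val_last, h3, Fin.val_zero, Nat.cast_zero, zero_mul]

theorem Samples.apply_inl_src (hs : Samples G p (fun e => w * √(g e)) a b c) (e : E) :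
    c (Sum.inl (G.src e)) = a e := by
  have := (hs e 0).1
  simpa using this

theorem Samples.apply_inl_tgt (hs : Samples G p (fun e => w * √(g e)) a b c) (e : E) :
    c (Sum.inl (G.tgt e)) = wave (w * √(g e)) (a e) (b e) 1 := by
  have := (hs e (Fin.last p)).2
  have h3 : (p : ℝ) * pieceLength p + pieceLength p = 1 := by
    rw [← succ_mul_pieceLength p]
    ring
  simpa [h3] using this

end Samples

/-- The initial slope on the edge `e` of the function with node values `c`. -/
noncomputable def initialSlope (G : QuantumGraph V E) (p : ℕ) (g : E → ℝ) (w : ℝ)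
    (c : V ⊕ E × Fin p → ℝ) (e : E) : ℝ :=
  (c ((G.subdivide p).tgt (e, 0)) -
    Real.cos (w * √(g e) * pieceLength p) * c (Sum.inl (G.src e))) /
      sinSol (w * √(g e)) (pieceLength p)

/-- Induction along the edge: the first piece fixes value and slope, and the kernel equation at each
new node says that the slopes agree there, so the same wave continues into the next piece. -/
theorem samples_of_mulVec_eq_zero (h : Admissible p g w) {c : V ⊕ E × Fin p → ℝ}
    (hc : (G.dtn p g w).mulVec c = 0) :
    Samples G p (fun e => w * √(g e)) (fun e => c (Sum.inl (G.src e)))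
      (G.initialSlope p g w c) c := by
  intro e j
  have hS := (h.sinSol_pos e).ne'
  have hl := (h.sqrt_pos e).ne'
  induction j using Fin.induction with
  | zero =>
    refine ⟨by simp, ?_⟩
    simp only [Fin.val_zero, Nat.cast_zero, zero_mul, zero_add]
    rw [wave, initialSlope]
    field_simp
    ring
  | succ i ih =>
    have hker := congrFun hc (Sum.inr (e, i))
    rw [dtn, subdivide_mulVec_inr] at hker
    obtain ⟨ih1, ih2⟩ := ih
    rw [subdivide_tgt_castSucc] at ih2
    simp only [Fin.val_castSucc] at ih1 ih2
    have hcast : ((i.succ : Fin (p + 1)) : ℝ) * pieceLength p =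
        i * pieceLength p + pieceLength p := by
      rw [Fin.val_succ]
      push_cast
      ring
    refine ⟨by rw [subdivide_src_succ, ih2, hcast], ?_⟩
    rw [hcast, wave_add]
    rw [ih1, ih2] at hker
    simp only [Pi.zero_apply, diagCoeff, offCoeff] at hker
    have h3 := cos_sq_add_sinSol_sq (w * √(g e)) (pieceLength p)
    rw [wave_add] at hker
    rw [wave_add, waveDeriv_add]
    generalize c ((G.subdivide p).tgt (e, i.succ)) = z at *
    generalize wave (w * √(g e)) (c (Sum.inl (G.src e))) (G.initialSlope p g w c e)
      (i * pieceLength p) = y at *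
    generalize waveDeriv (w * √(g e)) (c (Sum.inl (G.src e))) (G.initialSlope p g w c e)
      (i * pieceLength p) = y' at *
    generalize Real.cos (w * √(g e) * pieceLength p) = C at *
    generalize sinSol (w * √(g e)) (pieceLength p) = S at *
    field_simp at hker
    linear_combination -hker + y * h3

theorem outwardFlux_eq_of_samples (h : Admissible p g w) {a b : E → ℝ} {c : V ⊕ E × Fin p → ℝ}
    (hs : Samples G p (fun e => w * √(g e)) a b c) {f : EdgeFun E}
    (hf : ∀ e x, f e x = wave (w * √(g e)) (a e) (b e) x) (v : V) :
    G.outwardFlux g f v = -(G.dtn p g w).mulVec c (Sum.inl v) := by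
  classical
  rw [hs.mulVec_inl h, outwardFlux, ← Finset.sum_neg_distrib]
  refine Finset.sum_congr rfl fun e _ => ?_
  rw [edgeDeriv_eq_waveDeriv (hf e) (by simp), edgeDeriv_eq_waveDeriv (hf e) (by simp)]
  split_ifs <;> ring

theorem solves_of_samples (h : Admissible p g w) {a b : E → ℝ} {c : V ⊕ E × Fin p → ℝ}
    (hs : Samples G p (fun e => w * √(g e)) a b c) (hc : (G.dtn p g w).mulVec c = 0)
    {f : EdgeFun E} (hf : ∀ e x, f e x = wave (w * √(g e)) (a e) (b e) x) :
    G.Solves g (w ^ 2) f where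
  contDiffOn e := (contDiff_wave _ _ _).contDiffOn.congr (onEdge_eqOn_wave (hf e))
  laplacian_eq e x := by
    rw [laplacian, iteratedDerivWithin_two_eq_wave (hf e) x.2, hf, mul_pow,
      Real.sq_sqrt (h.isMetric e).le]
    have := (h.isMetric e).ne'
    field_simp
  matches_vertices := ⟨fun v => c (Sum.inl v), fun e => by
    simp only [hs.apply_inl_src, hs.apply_inl_tgt, hf]
    simp⟩
  flux_eq_zero v := by
    rw [outwardFlux_eq_of_samples h hs hf, hc]
    simp

/-- The function on the graph with node values `c`, as determined by the two first nodes of each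
edge. -/
noncomputable def reconstruct (G : QuantumGraph V E) (p : ℕ) (g : E → ℝ) (w : ℝ) :
    (V ⊕ E × Fin p → ℝ) →ₗ[ℝ] EdgeFun E where
  toFun c e x := wave (w * √(g e)) (c (Sum.inl (G.src e))) (G.initialSlope p g w c e) x
  map_add' c d := by
    funext e x
    simp only [wave, initialSlope, Pi.add_apply]
    ring
  map_smul' r c := by
    funext e x
    simp only [wave, initialSlope, Pi.smul_apply, smul_eq_mul, RingHom.id_apply]
    ring

theorem reconstruct_apply (c : V ⊕ E × Fin p → ℝ) (e : E) (x : Set.Icc (0 : ℝ) 1) :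
    G.reconstruct p g w c e x =
      wave (w * √(g e)) (c (Sum.inl (G.src e))) (G.initialSlope p g w c e) x := rfl

theorem solves_reconstruct (h : Admissible p g w) {c : V ⊕ E × Fin p → ℝ}
    (hc : (G.dtn p g w).mulVec c = 0) : G.Solves g (w ^ 2) (G.reconstruct p g w c) :=
  solves_of_samples h (samples_of_mulVec_eq_zero h hc) hc fun e x => reconstruct_apply c e x

theorem natCast_mul_pieceLength_mem (i : ℕ) (hi : i ≤ p + 1) :
    (i : ℝ) * pieceLength p ∈ Set.Icc (0 : ℝ) 1 := by
  have := pieceLength_pos p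
  refine ⟨by positivity, ?_⟩
  rw [← succ_mul_pieceLength p]
  have : (i : ℝ) ≤ p + 1 := by exact_mod_cast hi
  gcongr

/-- Every vertex is the end of an edge. -/
def NoIsolatedVertex (G : QuantumGraph V E) : Prop := ∀ v, ∃ e, G.src e = v ∨ G.tgt e = v

theorem Connected.noIsolatedVertex [Nonempty E] (hG : G.Connected) : G.NoIsolatedVertex := by
  intro v
  obtain ⟨e₀⟩ := ‹Nonempty E›
  by_cases hv : G.src e₀ = v
  · exact ⟨e₀, Or.inl hv⟩
  · obtain ⟨W⟩ := hG.preconnected v (G.src e₀)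
    cases W with
    | nil => exact absurd rfl hv
    | cons hadj _ =>
      rw [SimpleGraph.fromRel_adj] at hadj
      rcases hadj.2 with ⟨e, h1, _⟩ | ⟨e, _, h2⟩
      · exact ⟨e, Or.inl h1⟩
      · exact ⟨e, Or.inr h2⟩

theorem eq_zero_of_forall_piece (hG : G.NoIsolatedVertex) {c : V ⊕ E × Fin p → ℝ}
    (hc : ∀ q, c ((G.subdivide p).src q) = 0 ∧ c ((G.subdivide p).tgt q) = 0) : c = 0 := by
  funext v
  rcases v with v | ⟨e, i⟩
  · obtain ⟨e, rfl | rfl⟩ := hG v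
    · simpa using (hc (e, 0)).1
    · simpa using (hc (e, Fin.last p)).2
  · simpa using (hc (e, i.succ)).1

/-- Every node lies on some edge, where its value is a value of the reconstructed function. -/
theorem eq_zero_of_reconstruct_eq_zero (hG : G.NoIsolatedVertex) (h : Admissible p g w)
    {c : V ⊕ E × Fin p → ℝ} (hc : (G.dtn p g w).mulVec c = 0)
    (h0 : G.reconstruct p g w c = 0) : c = 0 := by
  have hs := samples_of_mulVec_eq_zero h hc
  refine eq_zero_of_forall_piece hG fun ⟨e, j⟩ => ?_
  have hval : ∀ i : ℕ, i ≤ p + 1 → wave (w * √(g e)) (c (Sum.inl (G.src e)))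
      (G.initialSlope p g w c e) (i * pieceLength p) = 0 := fun i hi => by
    have := congrFun (congrFun h0 e) ⟨_, natCast_mul_pieceLength_mem i hi⟩
    simpa [reconstruct_apply] using this
  obtain ⟨h1, h2⟩ := hs e j
  refine ⟨h1.trans (hval j (by omega)), h2.trans ?_⟩
  have := hval (j + 1) (by omega)
  push_cast at this
  rwa [add_mul, one_mul] at this

theorem exists_mulVec_eq_zero_of_solves (h : Admissible p g w) {f : EdgeFun E}
    (hf : G.Solves g (w ^ 2) f) :
    ∃ c, (G.dtn p g w).mulVec c = 0 ∧ G.reconstruct p g w c = f := by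
  obtain ⟨cv, hcv⟩ := hf.matches_vertices
  have hθ : ∀ e, (w * √(g e)) ^ 2 = w ^ 2 * g e := fun e => by
    rw [mul_pow, Real.sq_sqrt (h.isMetric e).le]
  have hw := fun e => hf.eq_wave h.isMetric e (hθ e)
  let b : E → ℝ := fun e => edgeDeriv f e 0
  let c : V ⊕ E × Fin p → ℝ := Sum.elim cv
    fun q => wave (w * √(g q.1)) (f q.1 0) (b q.1) (q.2 * pieceLength p + pieceLength p)
  have hs : Samples G p (fun e => w * √(g e)) (fun e => f e 0) b c := by
    intro e j
    constructor
    · induction j using Fin.cases with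
      | zero => simp [c, hcv]
      | succ i =>
        simp only [subdivide_src_succ, c, Sum.elim_inr, Fin.val_succ]
        push_cast
        ring_nf
    · induction j using Fin.lastCases with
      | last =>
        have h3 : (p : ℝ) * pieceLength p + pieceLength p = 1 := by
          rw [← succ_mul_pieceLength p]
          ring
        have := hw e 1
        simp only [subdivide_tgt_last, c, Sum.elim_inl, Fin.val_last, h3, ← (hcv e).2]
        exact this
      | cast i => simp [c]
  refine ⟨c, ?_, ?_⟩
  · funext v
    rcases v with v | ⟨e, i⟩
    · have := outwardFlux_eq_of_samples h hs hw v
      rw [hf.flux_eq_zero] at this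
      simpa using this.symm
    · exact hs.mulVec_inr h e i
  · funext e x
    rw [reconstruct_apply, hw e x, hs.apply_inl_src]
    congr 1
    have h1 := (hs e 0).2
    have hS := (h.sinSol_pos e).ne'
    simp only [Fin.val_zero, Nat.cast_zero, zero_mul, zero_add] at h1
    rw [initialSlope, hs.apply_inl_src, h1, wave]
    field_simp
    ring

/-- `reconstruct` maps the kernel bijectively onto the eigenspace: kernel equations at old vertices
are the flux conditions, those at new nodes say that the pieces join smoothly. -/
theorem finrank_eigenspace_eq (hG : G.NoIsolatedVertex) (h : Admissible p g w) :
    Module.finrank ℝ (G.eigenspace g (w ^ 2)) =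
      Module.finrank ℝ (LinearMap.ker (G.dtn p g w).mulVecLin) := by
  let K := LinearMap.ker (G.dtn p g w).mulVecLin
  have hK : ∀ c, c ∈ K ↔ (G.dtn p g w).mulVec c = 0 := fun c => by simp [K]
  have hr : LinearMap.range ((G.reconstruct p g w).domRestrict K) = G.eigenspace g (w ^ 2) := by
    ext f
    constructor
    · rintro ⟨⟨c, hc⟩, rfl⟩
      exact solves_reconstruct h ((hK c).1 hc)
    · intro hf
      obtain ⟨c, hc, rfl⟩ := exists_mulVec_eq_zero_of_solves h hf
      exact ⟨⟨c, (hK c).2 hc⟩, rfl⟩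
  rw [← hr, LinearMap.finrank_range_of_inj]
  rw [← LinearMap.ker_eq_bot, LinearMap.ker_eq_bot']
  rintro ⟨c, hc⟩ h0
  exact Subtype.ext (eq_zero_of_reconstruct_eq_zero hG h ((hK c).1 hc) h0)

theorem finrank_eigenspace_of_neg (hg : IsMetric g) {μ : ℝ} (hμ : μ < 0) :
    Module.finrank ℝ (G.eigenspace g μ) = 0 := by
  have : G.eigenspace g μ = ⊥ :=
    (Submodule.eq_bot_iff _).2 fun f hf => Solves.eq_zero_of_neg hf hg hμ
  rw [this, finrank_bot]

/-- The density `|∇f|² + w² f²` on the edge `e` of a function with frequency `w` and node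
values `c`. -/
noncomputable def nodeEnergy (G : QuantumGraph V E) (p : ℕ) (g : E → ℝ) (w : ℝ)
    (c : V ⊕ E × Fin p → ℝ) (e : E) : ℝ :=
  pieceLength p * ∑ j : Fin (p + 1), w ^ 2 / Real.sin (w * √(g e) * pieceLength p) ^ 2 *
    (c ((G.subdivide p).src (e, j)) ^ 2 + c ((G.subdivide p).tgt (e, j)) ^ 2 -
      2 * c ((G.subdivide p).src (e, j)) * c ((G.subdivide p).tgt (e, j)) *
        Real.cos (w * √(g e) * pieceLength p))

/-- The density equals the conserved quantity `(b² + θ² a²) / ℓ²`. Written through the end values of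
any piece it gives the same number, so the average over the `p + 1` pieces is that number too. -/
theorem energy_reconstruct (h : Admissible p g w) (hw : 0 < w) {c : V ⊕ E × Fin p → ℝ}
    (hc : (G.dtn p g w).mulVec c = 0) (e : E) (x : Set.Icc (0 : ℝ) 1) :
    gradNormSq g (G.reconstruct p g w c) e x + w ^ 2 * G.reconstruct p g w c e x ^ 2 =
      G.nodeEnergy p g w c e := by
  have hs := samples_of_mulVec_eq_zero h hc
  have hl := h.sqrt_pos e
  have hS := (h.sinSol_pos e).ne'
  have hsq : g e = √(g e) ^ 2 := (Real.sq_sqrt (h.isMetric e).le).symm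
  set a := c (Sum.inl (G.src e)) with ha
  set b := G.initialSlope p g w c e with hb
  set θ := w * √(g e) with hθ
  have h1 : gradNormSq g (G.reconstruct p g w c) e x + w ^ 2 * G.reconstruct p g w c e x ^ 2 =
      (b ^ 2 + θ ^ 2 * a ^ 2) / √(g e) ^ 2 := by
    rw [gradNormSq, edgeDeriv_eq_waveDeriv (fun x => reconstruct_apply c e x) x.2,
      reconstruct_apply, ← waveDeriv_sq_add θ a b x, ← hθ, ← ha, ← hb]
    generalize wave θ a b x = y
    generalize waveDeriv θ a b x = z
    rw [← hsq, hθ, mul_pow, ← hsq]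
    have := (h.isMetric e).ne'
    field_simp
  have h2 : ∀ j : Fin (p + 1), w ^ 2 / Real.sin (w * √(g e) * pieceLength p) ^ 2 *
    (c ((G.subdivide p).src (e, j)) ^ 2 + c ((G.subdivide p).tgt (e, j)) ^ 2 -
      2 * c ((G.subdivide p).src (e, j)) * c ((G.subdivide p).tgt (e, j)) *
        Real.cos (w * √(g e) * pieceLength p)) = (b ^ 2 + θ ^ 2 * a ^ 2) / √(g e) ^ 2 := by
    intro j
    have h3 := cos_sq_add_sinSol_sq θ (pieceLength p)
    rw [(hs e j).1, (hs e j).2, wave_add, ← waveDeriv_sq_add θ a b (j * pieceLength p),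
      ← mul_sinSol]
    simp only [← ha, ← hb, ← hθ]
    generalize wave θ a b (j * pieceLength p) = y
    generalize waveDeriv θ a b (j * pieceLength p) = z
    have hθ0 : θ ≠ 0 := by positivity
    have hw2 : w ^ 2 = θ ^ 2 / √(g e) ^ 2 := by
      rw [hθ]
      field_simp
    rw [hw2]
    generalize Real.cos (θ * pieceLength p) = C at *
    generalize sinSol θ (pieceLength p) = S at *
    have hl' := hl.ne'
    field_simp
    linear_combination (-y ^ 2) * h3
  rw [h1, nodeEnergy, Finset.sum_congr rfl fun j _ => h2 j]
  rw [Finset.sum_const, Finset.card_univ, Fintype.card_fin, nsmul_eq_mul]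
  have := succ_mul_pieceLength p
  push_cast
  linear_combination (-(b ^ 2 + θ ^ 2 * a ^ 2) / √(g e) ^ 2) * this

end QuantumGraph

/-! ### Monotonicity in the frequency and counting of eigenvalues. -/

namespace QuantumGraph

/-- This is the form of one piece with end values `a`, `b`, up to a positive factor. The numerator
of its derivative is minus half of `(a + b)² (θ + sin θ)(1 - cos θ) + (a - b)² (θ - sin θ)(1 + cos
θ)`, which is positive because `sin θ < θ`. -/
theorem strictAntiOn_piece {a b : ℝ} (hab : a ≠ 0 ∨ b ≠ 0) :
    StrictAntiOn (fun θ : ℝ => ((a ^ 2 + b ^ 2) * Real.cos θ - 2 * a * b) / Real.sinc θ)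
      (Set.Ico 0 Real.pi) := by
  refine strictAntiOn_of_deriv_neg (convex_Ico 0 Real.pi) ?_ ?_
  · refine ContinuousOn.div (by fun_prop) Real.continuous_sinc.continuousOn ?_
    exact fun θ hθ => (sinc_pos_of_lt_pi hθ.1 hθ.2).ne'
  · intro θ hθ
    rw [interior_Ico] at hθ
    obtain ⟨h0, hπ⟩ := hθ
    have hs := Real.sin_pos_of_pos_of_lt_pi h0 hπ
    have hev : (fun θ : ℝ => ((a ^ 2 + b ^ 2) * Real.cos θ - 2 * a * b) / Real.sinc θ) =ᶠ[𝓝 θ]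
        fun θ => θ * ((a ^ 2 + b ^ 2) * Real.cos θ - 2 * a * b) / Real.sin θ := by
      filter_upwards [eventually_ne_nhds h0.ne'] with y hy
      rw [Real.sinc_of_ne_zero hy, div_div_eq_mul_div, mul_comm y]
    have hd := (((hasDerivAt_id' θ).mul
      (((Real.hasDerivAt_cos θ).const_mul (a ^ 2 + b ^ 2)).sub_const (2 * a * b))).div
        (Real.hasDerivAt_sin θ) hs.ne')
    have hd' : deriv (fun θ => θ * ((a ^ 2 + b ^ 2) * Real.cos θ - 2 * a * b) / Real.sin θ) θ = _ :=
      hd.deriv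
    rw [hev.deriv_eq, hd']
    refine div_neg_of_neg_of_pos ?_ (by positivity)
    have hsc := Real.sin_sq_add_cos_sq θ
    have hc1 : Real.cos θ < 1 := by
      nlinarith [Real.cos_le_one θ, sq_pos_of_pos hs]
    have hc2 : -1 < Real.cos θ := by
      nlinarith [Real.neg_one_le_cos θ, sq_pos_of_pos hs]
    have hlt := Real.sin_lt h0
    have h1 : 0 < (θ + Real.sin θ) * (1 - Real.cos θ) := mul_pos (by linarith) (by linarith)
    have h2 : 0 < (θ - Real.sin θ) * (1 + Real.cos θ) := mul_pos (by linarith) (by linarith)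
    have h3 : 0 < (a + b) ^ 2 * ((θ + Real.sin θ) * (1 - Real.cos θ)) +
        (a - b) ^ 2 * ((θ - Real.sin θ) * (1 + Real.cos θ)) := by
      by_cases hs0 : a + b = 0
      · have : a - b ≠ 0 := by
          intro hd0
          rcases hab with h | h <;> apply h <;> linarith
        have := mul_pos (sq_pos_of_ne_zero this) h2
        rw [hs0]
        linarith
      · have := mul_pos (sq_pos_of_ne_zero hs0) h1
        have := mul_nonneg (sq_nonneg (a - b)) h2.le
        linarith
    have h4 : ((1 * ((a ^ 2 + b ^ 2) * Real.cos θ - 2 * a * b) +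
        θ * ((a ^ 2 + b ^ 2) * -Real.sin θ)) * Real.sin θ -
        θ * ((a ^ 2 + b ^ 2) * Real.cos θ - 2 * a * b) * Real.cos θ) =
        -((a + b) ^ 2 * ((θ + Real.sin θ) * (1 - Real.cos θ)) +
        (a - b) ^ 2 * ((θ - Real.sin θ) * (1 + Real.cos θ))) / 2 := by
      linear_combination (-(θ * (a ^ 2 + b ^ 2))) * hsc
    simp only [Pi.mul_apply]
    rw [h4]
    linarith

variable {V E : Type*} [Fintype V] [Fintype E] {G : QuantumGraph V E} {p : ℕ} {g : E → ℝ} {w : ℝ}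

theorem dtn_quadForm (c : V ⊕ E × Fin p → ℝ) :
    (G.dtn p g w).quadForm c = ∑ q : E × Fin (p + 1), 1 / (√(g q.1) * pieceLength p) *
      (((c ((G.subdivide p).src q) ^ 2 + c ((G.subdivide p).tgt q) ^ 2) *
        Real.cos (w * √(g q.1) * pieceLength p) -
        2 * c ((G.subdivide p).src q) * c ((G.subdivide p).tgt q)) /
          Real.sinc (w * √(g q.1) * pieceLength p)) := by
  rw [dtn, vertexMatrix_quadForm]
  refine Finset.sum_congr rfl fun q _ => ?_
  rw [diagCoeff, offCoeff, sinSol]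
  ring

theorem dtn_quadForm_lt (hG : G.NoIsolatedVertex) {w' : ℝ} (h : Admissible p g w') (hw : 0 ≤ w)
    (hlt : w < w') {c : V ⊕ E × Fin p → ℝ} (hc : c ≠ 0) :
    (G.dtn p g w').quadForm c < (G.dtn p g w).quadForm c := by
  have hδ := pieceLength_pos p
  have hterm : ∀ (q : E × Fin (p + 1)) (a b : ℝ), a ≠ 0 ∨ b ≠ 0 →
      1 / (√(g q.1) * pieceLength p) * (((a ^ 2 + b ^ 2) *
        Real.cos (w' * √(g q.1) * pieceLength p) - 2 * a * b) /
          Real.sinc (w' * √(g q.1) * pieceLength p)) <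
      1 / (√(g q.1) * pieceLength p) * (((a ^ 2 + b ^ 2) *
        Real.cos (w * √(g q.1) * pieceLength p) - 2 * a * b) /
          Real.sinc (w * √(g q.1) * pieceLength p)) := fun q a b hab => by
    have hl := h.sqrt_pos q.1
    refine mul_lt_mul_of_pos_left (strictAntiOn_piece hab ⟨by positivity, ?_⟩
      ⟨mul_nonneg (mul_nonneg h.nonneg hl.le) hδ.le, h.lt_pi q.1⟩ ?_) (by positivity)
    · exact (h.mono hw hlt.le).lt_pi q.1
    · gcongr
  rw [dtn_quadForm, dtn_quadForm]
  refine Finset.sum_lt_sum (fun q _ => ?_) ?_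
  · by_cases hq : c ((G.subdivide p).src q) ≠ 0 ∨ c ((G.subdivide p).tgt q) ≠ 0
    · exact (hterm q _ _ hq).le
    · push Not at hq
      simp [hq.1, hq.2]
  · by_contra! hcon
    refine hc (eq_zero_of_forall_piece hG fun q => ?_)
    by_contra hq
    rw [not_and_or] at hq
    exact (hterm q _ _ hq).not_ge (hcon q (Finset.mem_univ q))

theorem continuousOn_dtn {W : ℝ} (h : Admissible p g W) (u v : V ⊕ E × Fin p) :
    ContinuousOn (fun w => G.dtn p g w u v) (Set.Icc 0 W) := by
  have hS : ∀ e, ContinuousOn (fun w => √(g e) * sinSol (w * √(g e)) (pieceLength p))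
      (Set.Icc 0 W) := fun e => by
    have := Real.continuous_sinc
    unfold sinSol
    fun_prop
  have hne : ∀ e, ∀ w ∈ Set.Icc 0 W, √(g e) * sinSol (w * √(g e)) (pieceLength p) ≠ 0 :=
    fun e w hw => (mul_pos (h.sqrt_pos e) ((h.mono hw.1 hw.2).sinSol_pos e)).ne'
  have hP : ∀ e, ContinuousOn (fun w => diagCoeff p w √(g e)) (Set.Icc 0 W) := fun e =>
    ContinuousOn.div (by fun_prop) (hS e) (hne e)
  have hQ : ∀ e, ContinuousOn (fun w => offCoeff p w √(g e)) (Set.Icc 0 W) := fun e =>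
    ContinuousOn.div (by fun_prop) (hS e) (hne e)
  simp only [dtn, vertexMatrix, Matrix.of_apply]
  refine continuousOn_finsetSum _ fun q _ => ContinuousOn.add ?_ ?_
  · split_ifs <;> first | exact continuousOn_const |
      exact ((hP q.1).mul continuousOn_const).sub ((hQ q.1).mul continuousOn_const)
  · split_ifs <;> first | exact continuousOn_const |
      exact ((hP q.1).mul continuousOn_const).sub ((hQ q.1).mul continuousOn_const)

/-- The sorted eigenvalues of the Dirichlet-to-Neumann matrix. -/
noncomputable def dtnEig (G : QuantumGraph V E) (p : ℕ) (g : E → ℝ) (w : ℝ) :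
    Fin (Fintype.card (V ⊕ E × Fin p)) → ℝ := (G.dtn_isHermitian p g w).sortedEig

theorem dtnEig_strictAntiOn (hG : G.NoIsolatedVertex) {W : ℝ} (h : Admissible p g W)
    (i : Fin (Fintype.card (V ⊕ E × Fin p))) :
    StrictAntiOn (fun w => G.dtnEig p g w i) (Set.Icc 0 W) := fun _ hw _ hw' hlt =>
  (G.dtn_isHermitian p g _).sortedEig_lt (G.dtn_isHermitian p g _)
    (fun _ hc => dtn_quadForm_lt hG (h.mono hw'.1 hw'.2) hw.1 hlt hc) i

theorem dtnEig_continuousOn {W : ℝ} (h : Admissible p g W)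
    (i : Fin (Fintype.card (V ⊕ E × Fin p))) :
    ContinuousOn (fun w => G.dtnEig p g w i) (Set.Icc 0 W) :=
  Matrix.continuousOn_sortedEig (G.dtn_isHermitian p g) (continuousOn_dtn h) i

theorem dtn_zero_quadForm (c : V ⊕ E × Fin p → ℝ) :
    (G.dtn p g 0).quadForm c = ∑ q : E × Fin (p + 1), 1 / (√(g q.1) * pieceLength p) *
      (c ((G.subdivide p).src q) - c ((G.subdivide p).tgt q)) ^ 2 := by
  rw [dtn_quadForm]
  refine Finset.sum_congr rfl fun q _ => ?_
  simp only [zero_mul, Real.cos_zero, Real.sinc_zero]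
  ring

theorem dtnEig_zero_nonneg (i : Fin (Fintype.card (V ⊕ E × Fin p))) :
    0 ≤ G.dtnEig p g 0 i := by
  refine (G.dtn_isHermitian p g 0).le_sortedEig (S := ⊤) ?_ fun c _ => ?_
  · rw [finrank_top, Module.finrank_fintype_fun_eq_card]
    omega
  · rw [zero_mul, dtn_zero_quadForm]
    have := pieceLength_pos p
    exact Finset.sum_nonneg fun q _ => by positivity

theorem eq_const_of_quadForm_nonpos [Nonempty E] (hG : G.Connected) (hg : IsMetric g)
    {c : V ⊕ E × Fin p → ℝ} (hc : (G.dtn p g 0).quadForm c ≤ 0) : ∃ x, c = fun _ => x := by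
  have hδ := pieceLength_pos p
  have hnn : ∀ q ∈ (Finset.univ : Finset (E × Fin (p + 1))), 0 ≤
      1 / (√(g q.1) * pieceLength p) *
        (c ((G.subdivide p).src q) - c ((G.subdivide p).tgt q)) ^ 2 :=
    fun q _ => by positivity
  rw [dtn_zero_quadForm] at hc
  have h0 := (Finset.sum_eq_zero_iff_of_nonneg hnn).1 (le_antisymm hc (Finset.sum_nonneg hnn))
  have heq : ∀ q, c ((G.subdivide p).src q) = c ((G.subdivide p).tgt q) := fun q => by
    have h1 := h0 q (Finset.mem_univ q)
    have h2 : 1 / (√(g q.1) * pieceLength p) ≠ 0 := by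
      have := Real.sqrt_pos.2 (hg q.1)
      positivity
    have h3 := (mul_eq_zero.1 h1).resolve_left h2
    have := pow_eq_zero_iff two_ne_zero |>.1 h3
    linarith
  have hsrc : ∀ e (j : Fin (p + 1)), c ((G.subdivide p).src (e, j)) = c (Sum.inl (G.src e)) := by
    intro e j
    induction j using Fin.induction with
    | zero => simp
    | succ i ih => rw [subdivide_src_succ, ← subdivide_tgt_castSucc, ← heq, ih]
  have htgt : ∀ e, c (Sum.inl (G.src e)) = c (Sum.inl (G.tgt e)) := fun e => by
    rw [← hsrc e (Fin.last p), heq, subdivide_tgt_last]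
  obtain ⟨v₀⟩ := hG.nonempty
  have hV : ∀ v, c (Sum.inl v) = c (Sum.inl v₀) := by
    intro v
    obtain ⟨W⟩ := hG.preconnected v v₀
    induction W with
    | nil => rfl
    | cons hadj _ ih =>
      rw [← ih]
      rw [SimpleGraph.fromRel_adj] at hadj
      rcases hadj.2 with ⟨e, rfl, rfl⟩ | ⟨e, rfl, rfl⟩
      · exact htgt e
      · exact (htgt e).symm
  refine ⟨c (Sum.inl v₀), funext fun v => ?_⟩
  rcases v with v | ⟨e, i⟩
  · exact hV v
  · rw [← subdivide_src_succ, hsrc, hV]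

/-- At frequency 0 the form is a weighted sum of squared differences, and on a connected graph it
vanishes only on constants. If the eigenvalue were not positive, `lowSpan i`, of dimension at least
2, would consist of constants. -/
theorem dtnEig_zero_pos [Nonempty E] (hG : G.Connected) (hg : IsMetric g)
    {i : Fin (Fintype.card (V ⊕ E × Fin p))} (hi : 1 ≤ (i : ℕ)) : 0 < G.dtnEig p g 0 i := by
  by_contra! hle
  have h1 : (G.dtn_isHermitian p g 0).lowSpan i ≤ Submodule.span ℝ {fun _ => (1 : ℝ)} := by
    intro c hc
    obtain ⟨x, rfl⟩ := eq_const_of_quadForm_nonpos hG hg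
      (((G.dtn_isHermitian p g 0).quadForm_le_of_mem_lowSpan hc).trans
        (mul_nonpos_of_nonpos_of_nonneg hle
          (Finset.sum_nonneg fun j _ => mul_self_nonneg (c j))))
    exact Submodule.mem_span_singleton.2 ⟨x, by ext; simp⟩
  have h2 := Submodule.finrank_mono h1
  rw [Matrix.IsHermitian.finrank_lowSpan] at h2
  have h3 := h2.trans (finrank_span_le_card _)
  simp at h3
  omega

/-- The set whose infimum is the eigenvalue `λ_j`. -/
def countSet (G : QuantumGraph V E) (j : ℕ) (g : E → ℝ) : Set ℝ :=
  {x : ℝ | ∃ s : Finset ℝ, (∀ μ ∈ s, μ ≤ x) ∧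
    j + 1 ≤ ∑ μ ∈ s, Module.finrank ℝ (G.eigenspace g μ)}

theorem nonneg_of_mem_countSet (hg : IsMetric g) {j : ℕ} {x : ℝ} (hx : x ∈ G.countSet j g) :
    0 ≤ x := by
  obtain ⟨s, hs, hsum⟩ := hx
  by_contra! hneg
  rw [Finset.sum_eq_zero fun μ hμ =>
    finrank_eigenspace_of_neg hg ((hs μ hμ).trans_lt hneg)] at hsum
  omega

theorem finrank_eigenspace_eq_card (hG : G.NoIsolatedVertex) {W : ℝ} (h : Admissible p g W) :
    Module.finrank ℝ (G.eigenspace g (W ^ 2)) =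
      (Finset.univ.filter fun i => G.dtnEig p g W i = 0).card := by
  rw [finrank_eigenspace_eq hG h, (G.dtn_isHermitian p g W).finrank_ker_mulVecLin,
    Set.ncard_eq_toFinset_card']
  congr 1
  ext i
  simp only [Set.mem_toFinset, Finset.mem_filter, Finset.mem_univ, true_and]
  exact Iff.rfl

/-- An eigenvalue `μ` of multiplicity `m` accounts for `m` indices whose branch vanishes at `√μ`,
and by strict monotonicity different `μ` use different indices. If branch `j` were positive at `W`,
all these indices would be below `j`, leaving at most `j` eigenvalues. -/
theorem dtnEig_nonpos_of_mem_countSet (hG : G.NoIsolatedVertex) {W : ℝ} (h : Admissible p g W)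
    {j : Fin (Fintype.card (V ⊕ E × Fin p))} (hx : W ^ 2 ∈ G.countSet j g) :
    G.dtnEig p g W j ≤ 0 := by
  classical
  obtain ⟨s, hs, hsum⟩ := hx
  by_contra! hpos
  have hle : ∀ μ ∈ s, 0 ≤ μ → √μ ∈ Set.Icc 0 W := fun μ hμ h0 =>
    ⟨Real.sqrt_nonneg _, by
      rw [← Real.sqrt_sq h.nonneg]
      exact Real.sqrt_le_sqrt (hs μ hμ)⟩
  let t : ℝ → Finset (Fin (Fintype.card (V ⊕ E × Fin p))) := fun μ =>
    Finset.univ.filter fun i => G.dtnEig p g √μ i = 0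
  have h1 : ∑ μ ∈ s, Module.finrank ℝ (G.eigenspace g μ) =
      ∑ μ ∈ s.filter (0 ≤ ·), (t μ).card := by
    rw [Finset.sum_filter]
    refine Finset.sum_congr rfl fun μ hμ => ?_
    split_ifs with h0
    · have h2 := finrank_eigenspace_eq_card hG (h.mono (hle μ hμ h0).1 (hle μ hμ h0).2)
      rwa [Real.sq_sqrt h0] at h2
    · exact finrank_eigenspace_of_neg h.isMetric (not_le.1 h0)
  have hdisj : ((s.filter (0 ≤ ·) : Finset ℝ) : Set ℝ).PairwiseDisjoint t := by
    intro μ hμ ν hν hne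
    rw [Finset.mem_coe, Finset.mem_filter] at hμ hν
    refine Finset.disjoint_left.2 fun i hi hi' => hne ?_
    simp only [t, Finset.mem_filter, Finset.mem_univ, true_and] at hi hi'
    have := (dtnEig_strictAntiOn hG h i).injOn (hle μ hμ.1 hμ.2) (hle ν hν.1 hν.2)
      (hi.trans hi'.symm)
    rwa [Real.sqrt_inj hμ.2 hν.2] at this
  have hsub : (s.filter (0 ≤ ·)).biUnion t ⊆ Finset.univ.filter (· < j) := by
    intro i hi
    simp only [Finset.mem_biUnion, Finset.mem_filter, Finset.mem_univ, true_and, t] at hi ⊢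
    obtain ⟨μ, ⟨hμ, h0⟩, hz⟩ := hi
    by_contra! hji
    have h3 := (dtnEig_strictAntiOn hG h i).antitoneOn (hle μ hμ h0)
      (Set.right_mem_Icc.2 h.nonneg) (hle μ hμ h0).2
    have h4 := (G.dtn_isHermitian p g W).sortedEig_monotone hji
    simp only [dtnEig] at *
    linarith
  have h2 := Finset.card_le_card hsub
  rw [Finset.card_biUnion hdisj, ← h1] at h2
  have h5 : (Finset.univ.filter (· < j)).card = (j : ℕ) := by
    rw [show Finset.univ.filter (· < j) = Finset.Iio j by ext; simp, Fin.card_Iio]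
  omega

theorem exists_dtnEig_eq_zero {W : ℝ} (h : Admissible p g W)
    {i : Fin (Fintype.card (V ⊕ E × Fin p))} (hi : G.dtnEig p g W i ≤ 0) :
    ∃ z ∈ Set.Icc 0 W, G.dtnEig p g z i = 0 :=
  intermediate_value_Icc' h.nonneg (dtnEig_continuousOn h i) ⟨hi, dtnEig_zero_nonneg i⟩

theorem mem_countSet_of_dtnEig_nonpos (hG : G.NoIsolatedVertex) {W : ℝ} (h : Admissible p g W)
    {j : Fin (Fintype.card (V ⊕ E × Fin p))} (hj : G.dtnEig p g W j ≤ 0) :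
    W ^ 2 ∈ G.countSet j g := by
  classical
  have hz : ∀ i : Fin (Fintype.card (V ⊕ E × Fin p)), ∃ z, i ≤ j →
      z ∈ Set.Icc 0 W ∧ G.dtnEig p g z i = 0 := fun i => by
    by_cases hij : i ≤ j
    · obtain ⟨z, hz⟩ := exists_dtnEig_eq_zero h
        (((G.dtn_isHermitian p g W).sortedEig_monotone hij).trans hj)
      exact ⟨z, fun _ => hz⟩
    · exact ⟨0, fun hc => absurd hc hij⟩
  choose z hz using hz
  refine ⟨(Finset.Iic j).image fun i => z i ^ 2, ?_, ?_⟩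
  · intro μ hμ
    obtain ⟨i, hi, rfl⟩ := Finset.mem_image.1 hμ
    have := (hz i (Finset.mem_Iic.1 hi)).1
    exact pow_le_pow_left₀ this.1 this.2 2
  · have hcard : (Finset.Iic j).card = (j : ℕ) + 1 := by simp
    -- The `j + 1` indices are grouped by their zero; each group has at most as many members as the
    -- multiplicity of that eigenvalue.
    rw [← hcard, Finset.card_eq_sum_card_image (fun i => z i ^ 2) (Finset.Iic j)]
    refine Finset.sum_le_sum fun μ hμ => ?_
    obtain ⟨i, hi, rfl⟩ := Finset.mem_image.1 hμ
    obtain ⟨hi1, hi2⟩ := hz i (Finset.mem_Iic.1 hi)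
    rw [finrank_eigenspace_eq_card hG (h.mono hi1.1 hi1.2)]
    refine Finset.card_le_card fun l hl => ?_
    rw [Finset.mem_filter, Finset.mem_Iic] at hl
    obtain ⟨hl1, hl2⟩ := hz l hl.1
    rw [sq_eq_sq₀ hl1.1 hi1.1] at hl
    simpa [← hl.2] using hl2

/-- The two counting lemmas identify `countSet` below `W²` through the sign of branch `j`, so the
infimum is attained at the zero of that branch. -/
theorem exists_eigenvalue_eq_sq (hG : G.NoIsolatedVertex) {W : ℝ} (h : Admissible p g W)
    {j : Fin (Fintype.card (V ⊕ E × Fin p))} (hj : G.dtnEig p g W j ≤ 0) :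
    ∃ z ∈ Set.Icc 0 W, G.dtnEig p g z j = 0 ∧ G.eigenvalue j g = z ^ 2 := by
  obtain ⟨z, hz, hz0⟩ := exists_dtnEig_eq_zero h hj
  refine ⟨z, hz, hz0, IsLeast.csInf_eq (s := G.countSet j g)
    ⟨mem_countSet_of_dtnEig_nonpos hG (h.mono hz.1 hz.2) hz0.le, fun x hx => ?_⟩⟩
  have hx0 := nonneg_of_mem_countSet h.isMetric hx
  by_contra! hlt
  have hlt' : √x < z := (Real.sqrt_lt' (lt_of_le_of_ne hz.1 fun h0 => by
    rw [← h0] at hlt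
    linarith)).2 hlt
  have hmem : √x ∈ Set.Icc 0 W := ⟨Real.sqrt_nonneg _, hlt'.le.trans hz.2⟩
  have h1 := dtnEig_strictAntiOn hG h j hmem hz hlt'
  have h2 := dtnEig_nonpos_of_mem_countSet hG (h.mono hmem.1 hmem.2) (j := j)
    (by rwa [Real.sq_sqrt hx0])
  simp only at h1
  linarith

theorem eigenvalue_lt_sq (hG : G.NoIsolatedVertex) {W : ℝ} (h : Admissible p g W)
    {j : Fin (Fintype.card (V ⊕ E × Fin p))} (hj : G.dtnEig p g W j < 0) :
    G.eigenvalue j g < W ^ 2 := by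
  obtain ⟨z, hz, hz0, heq⟩ := exists_eigenvalue_eq_sq hG h hj.le
  rw [heq]
  refine pow_lt_pow_left₀ (lt_of_le_of_ne hz.2 ?_) hz.1 two_ne_zero
  rintro rfl
  linarith

/-- The sign at `W` guarantees that branch `j` has a zero; the sign at `w` places this zero to the
right of `w`. -/
theorem sq_lt_eigenvalue (hG : G.NoIsolatedVertex) {W : ℝ} (h : Admissible p g W)
    {j : Fin (Fintype.card (V ⊕ E × Fin p))} (hj : G.dtnEig p g W j ≤ 0) (hw : w ∈ Set.Icc 0 W)
    (hpos : 0 < G.dtnEig p g w j) : w ^ 2 < G.eigenvalue j g := by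
  obtain ⟨z, hz, hz0, heq⟩ := exists_eigenvalue_eq_sq hG h hj
  rw [heq]
  refine pow_lt_pow_left₀ ?_ hw.1 two_ne_zero
  by_contra! hle
  have := (dtnEig_strictAntiOn hG h j).antitoneOn hz hw hle
  linarith

/-- Test vectors supported on every other new node of `e₀`: no piece has both ends in the support,
so the cross terms vanish and the negative cosine decides the sign. The `j + 1` positions `0, 2, …,
2j` are available because `2j < p`. -/
theorem dtnEig_neg_of_pi_div_two_lt (hG : G.NoIsolatedVertex) {W : ℝ} (h : Admissible p g W)
    {e₀ : E} (he₀ : Real.pi / 2 < W * √(g e₀) * pieceLength p)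
    {j : Fin (Fintype.card (V ⊕ E × Fin p))} (hj : 2 * (j : ℕ) < p) : G.dtnEig p g W j < 0 := by
  classical
  let ι : Fin ((j : ℕ) + 1) → V ⊕ E × Fin p :=
    fun i => Sum.inr (e₀, ⟨2 * i, by have := i.2; omega⟩)
  have hι : Function.Injective ι := by
    intro i i' hii
    simp only [ι, Sum.inr.injEq, Prod.mk.injEq, Fin.mk.injEq, true_and] at hii
    exact Fin.ext (by omega)
  let J := Function.ExtendByZero.linearMap ℝ ι
  have hJι : ∀ (a : Fin ((j : ℕ) + 1) → ℝ) i, J a (ι i) = a i := fun a i => hι.extend_apply a 0 i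
  have hJ0 : ∀ (a : Fin ((j : ℕ) + 1) → ℝ) v, (¬ ∃ i, ι i = v) → J a v = 0 := fun a v hv =>
    Function.extend_apply' (f := ι) a (0 : V ⊕ E × Fin p → ℝ) v hv
  have hJ : Function.Injective J := fun a a' haa => funext fun i => by
    rw [← hJι a i, haa, hJι]
  refine (G.dtn_isHermitian p g W).sortedEig_neg (S := LinearMap.range J) ?_ ?_
  · rw [LinearMap.finrank_range_of_inj hJ]
    simp
  · rintro _ ⟨a, rfl⟩ hne
    set c := J a with hc
    have hinl : ∀ v, c (Sum.inl v) = 0 := fun v => hJ0 a _ (by rintro ⟨i, hi⟩; simp [ι] at hi)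
    have hinr : ∀ e (i : Fin p), c (Sum.inr (e, i)) ≠ 0 → e = e₀ ∧ Even (i : ℕ) := by
      intro e i hi
      by_contra hcon
      refine hi (hJ0 a _ ?_)
      rintro ⟨l, hl⟩
      simp only [ι, Sum.inr.injEq, Prod.mk.injEq] at hl
      exact hcon ⟨hl.1.symm, by rw [← hl.2]; exact even_two_mul _⟩
    have hsrc : ∀ e (i : Fin (p + 1)), c ((G.subdivide p).src (e, i)) ≠ 0 →
        e = e₀ ∧ Odd (i : ℕ) := by
      intro e i hi
      induction i using Fin.cases with
      | zero => exact absurd (hinl _) hi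
      | succ i =>
        obtain ⟨h1, h2⟩ := hinr e i hi
        exact ⟨h1, by rw [Fin.val_succ]; exact h2.add_one⟩
    have htgt : ∀ e (i : Fin (p + 1)), c ((G.subdivide p).tgt (e, i)) ≠ 0 →
        e = e₀ ∧ Even (i : ℕ) := by
      intro e i hi
      induction i using Fin.lastCases with
      | last =>
        rw [subdivide_tgt_last] at hi
        exact absurd (hinl _) hi
      | cast i =>
        rw [subdivide_tgt_castSucc] at hi
        exact hinr e i hi
    have hcos : Real.cos (W * √(g e₀) * pieceLength p) < 0 :=
      Real.cos_neg_of_pi_div_two_lt_of_lt he₀ (by linarith [h.lt_pi e₀, Real.pi_pos])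
    have hδ := pieceLength_pos p
    have hl := h.sqrt_pos e₀
    have hsinc : 0 < Real.sinc (W * √(g e₀) * pieceLength p) :=
      sinc_pos_of_lt_pi (by linarith [Real.pi_pos]) (h.lt_pi e₀)
    have hterm : ∀ q : E × Fin (p + 1), (c ((G.subdivide p).src q) ≠ 0 ∨
        c ((G.subdivide p).tgt q) ≠ 0) → 1 / (√(g q.1) * pieceLength p) *
      (((c ((G.subdivide p).src q) ^ 2 + c ((G.subdivide p).tgt q) ^ 2) *
        Real.cos (W * √(g q.1) * pieceLength p) -
        2 * c ((G.subdivide p).src q) * c ((G.subdivide p).tgt q)) /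
          Real.sinc (W * √(g q.1) * pieceLength p)) < 0 := by
      rintro ⟨e, i⟩ hq
      have he : e = e₀ := hq.elim (fun h => (hsrc e i h).1) fun h => (htgt e i h).1
      subst he
      have hprod : c ((G.subdivide p).src (e, i)) * c ((G.subdivide p).tgt (e, i)) = 0 := by
        by_contra hcon
        have h1 := (hsrc e i (left_ne_zero_of_mul hcon)).2
        have h2 := (htgt e i (right_ne_zero_of_mul hcon)).2
        exact (Nat.not_even_iff_odd.2 h1) h2
      rw [mul_assoc 2, hprod, mul_zero, sub_zero]
      have hsum : 0 < c ((G.subdivide p).src (e, i)) ^ 2 + c ((G.subdivide p).tgt (e, i)) ^ 2 := by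
        rcases hq with hq | hq <;> positivity
      exact mul_neg_of_pos_of_neg (by positivity)
        (div_neg_of_neg_of_pos (mul_neg_of_pos_of_neg hsum hcos) hsinc)
    rw [dtn_quadForm]
    refine Finset.sum_neg' (fun q _ => ?_) ?_
    · by_cases hq : c ((G.subdivide p).src q) ≠ 0 ∨ c ((G.subdivide p).tgt q) ≠ 0
      · exact (hterm q hq).le
      · push Not at hq
        simp [hq.1, hq.2]
    · by_contra! hcon
      refine hne (eq_zero_of_forall_piece hG fun q => ?_)
      by_contra hq
      rw [not_and_or] at hq
      exact (hterm q hq).not_ge (hcon q (Finset.mem_univ q))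

end QuantumGraph

/-! ### Energies and first-order bounds for eigenvalues along a path of metrics. -/

namespace Matrix

variable {n : Type*} [Fintype n]

theorem quadForm_neg (M : Matrix n n ℝ) (c : n → ℝ) : (-M).quadForm c = -M.quadForm c := by
  rw [quadForm, neg_mulVec, dotProduct_neg]
  rfl

theorem eventually_quadForm_pos {Φ : ℝ → Matrix n n ℝ} {D : Matrix n n ℝ}
    (hD : ∀ i j, HasDerivAt (fun t => Φ t i j) (D i j) 0) {S : Submodule ℝ (n → ℝ)}
    (hS : ∀ c ∈ S, c ≠ 0 → 0 ≤ (Φ 0).quadForm c)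
    (hS' : ∀ c ∈ S, c ≠ 0 → (Φ 0).quadForm c = 0 → 0 < D.quadForm c) :
    ∀ᶠ t in 𝓝[>] 0, ∀ c ∈ S, c ≠ 0 → 0 < (Φ t).quadForm c := by
  have := eventually_quadForm_neg (Φ := fun t => -Φ t) (D := -D) (S := S)
    (fun i j => (hD i j).fun_neg)
    (fun c hc h0 => by simpa [quadForm_neg] using hS c hc h0)
    (fun c hc h0 h => by simpa [quadForm_neg] using hS' c hc h0 (by simpa [quadForm_neg] using h))
  simpa [quadForm_neg] using this

theorem add_one_le_finrank_sup_span {S : Submodule ℝ (n → ℝ)} {f : n → ℝ} (hf : f ∉ S) :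
    Module.finrank ℝ S + 1 ≤ Module.finrank ℝ ↥(S ⊔ Submodule.span ℝ {f}) :=
  Submodule.finrank_lt_finrank_of_lt (lt_of_le_of_ne le_sup_left fun h => hf (by
    rw [h]
    exact Submodule.mem_sup_right (Submodule.mem_span_singleton_self f)))

end Matrix

namespace QuantumGraph

variable {V E : Type*} [Fintype V] [Fintype E] {G : QuantumGraph V E} {p : ℕ} {g : E → ℝ} {w : ℝ}

section NodeEnergy

theorem piece_energy_pos {θ a b : ℝ} (hθ : Real.sin θ ≠ 0) (hab : a ≠ 0 ∨ b ≠ 0) :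
    0 < a ^ 2 + b ^ 2 - 2 * a * b * Real.cos θ := by
  have h1 := Real.sin_sq_add_cos_sq θ
  have h2 : a ^ 2 + b ^ 2 - 2 * a * b * Real.cos θ =
      (a - b * Real.cos θ) ^ 2 + b ^ 2 * Real.sin θ ^ 2 := by
    linear_combination (-b ^ 2) * h1
  rw [h2]
  by_cases hb : b = 0
  · subst hb
    have := hab.resolve_right (by simp)
    simp only [zero_mul, sub_zero]
    positivity
  · positivity

theorem sin_piece_ne_zero (h : Admissible p g w) (hw : 0 < w) (e : E) :
    Real.sin (w * √(g e) * pieceLength p) ≠ 0 := by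
  have := h.sqrt_pos e
  have := pieceLength_pos p
  exact (Real.sin_pos_of_pos_of_lt_pi (by positivity) (h.lt_pi e)).ne'

theorem nodeEnergy_nonneg (h : Admissible p g w) (hw : 0 < w) (c : V ⊕ E × Fin p → ℝ) (e : E) :
    0 ≤ G.nodeEnergy p g w c e := by
  have hδ := pieceLength_pos p
  refine mul_nonneg hδ.le (Finset.sum_nonneg fun j _ => mul_nonneg (by positivity) ?_)
  by_cases hab : c ((G.subdivide p).src (e, j)) ≠ 0 ∨ c ((G.subdivide p).tgt (e, j)) ≠ 0
  · exact (piece_energy_pos (sin_piece_ne_zero h hw e) hab).le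
  · push Not at hab
    simp [hab.1, hab.2]

/-- The total energy `∫ |∇f|² + w² f²` of a function with node values `c`. -/
noncomputable def totalEnergy (G : QuantumGraph V E) (p : ℕ) (g : E → ℝ) (w : ℝ)
    (c : V ⊕ E × Fin p → ℝ) : ℝ := ∑ e, √(g e) * G.nodeEnergy p g w c e

theorem totalEnergy_pos (hG : G.NoIsolatedVertex) (h : Admissible p g w) (hw : 0 < w)
    {c : V ⊕ E × Fin p → ℝ} (hc : c ≠ 0) : 0 < G.totalEnergy p g w c := by
  have hδ := pieceLength_pos p
  have hnn : ∀ e ∈ Finset.univ, 0 ≤ √(g e) * G.nodeEnergy p g w c e :=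
    fun e _ => mul_nonneg (Real.sqrt_nonneg _) (nodeEnergy_nonneg h hw c e)
  refine lt_of_le_of_ne (Finset.sum_nonneg hnn) fun h0 => hc ?_
  rw [totalEnergy, eq_comm, Finset.sum_eq_zero_iff_of_nonneg hnn] at h0
  refine eq_zero_of_forall_piece hG fun ⟨e, j⟩ => ?_
  by_contra hq
  rw [not_and_or] at hq
  have h1 := (mul_eq_zero.1 (h0 e (Finset.mem_univ e))).resolve_left (h.sqrt_pos e).ne'
  have hs := sin_piece_ne_zero h hw e
  refine h1.not_gt (mul_pos hδ ?_)
  refine Finset.sum_pos' (fun i _ => mul_nonneg (by positivity) ?_)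
    ⟨j, Finset.mem_univ j, mul_pos (by positivity) (piece_energy_pos hs hq)⟩
  by_cases hab : c ((G.subdivide p).src (e, i)) ≠ 0 ∨ c ((G.subdivide p).tgt (e, i)) ≠ 0
  · exact (piece_energy_pos hs hab).le
  · push Not at hab
    simp [hab.1, hab.2]

theorem nodeEnergy_smul (r : ℝ) (c : V ⊕ E × Fin p → ℝ) (e : E) :
    G.nodeEnergy p g w (r • c) e = r ^ 2 * G.nodeEnergy p g w c e := by
  simp only [nodeEnergy, Pi.smul_apply, smul_eq_mul, Finset.mul_sum]
  exact Finset.sum_congr rfl fun j _ => by ring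

theorem totalEnergy_smul (r : ℝ) (c : V ⊕ E × Fin p → ℝ) :
    G.totalEnergy p g w (r • c) = r ^ 2 * G.totalEnergy p g w c := by
  simp only [totalEnergy, nodeEnergy_smul, Finset.mul_sum]
  exact Finset.sum_congr rfl fun j _ => by ring

theorem continuous_nodeEnergy (e : E) : Continuous fun c => G.nodeEnergy p g w c e := by
  unfold nodeEnergy
  fun_prop

theorem continuous_totalEnergy : Continuous fun c => G.totalEnergy p g w c :=
  continuous_finsetSum _ fun e _ => continuous_const.mul (continuous_nodeEnergy e)

end NodeEnergy

theorem totalLength_pos [Nonempty E] (hg : IsMetric g) : 0 < totalLength g :=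
  Finset.sum_pos (fun e _ => Real.sqrt_pos.2 (hg e)) Finset.univ_nonempty

section Perturbation

variable {γ : ℝ → E → ℝ} {ℓ' : E → ℝ}

theorem mul_sinSol_eq_sin_div {w : ℝ} (hw : w ≠ 0) (ℓ x : ℝ) :
    ℓ * sinSol (w * ℓ) x = Real.sin (w * ℓ * x) / w := by
  rw [← mul_sinSol]
  field_simp

theorem diagCoeff_eq {w : ℝ} (hw : w ≠ 0) (ℓ : ℝ) :
    diagCoeff p w ℓ =
      w * Real.cos (w * ℓ * pieceLength p) / Real.sin (w * ℓ * pieceLength p) := by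
  rw [diagCoeff, mul_sinSol_eq_sin_div hw, div_div_eq_mul_div, mul_comm w (Real.cos _)]

theorem offCoeff_eq {w : ℝ} (hw : w ≠ 0) (ℓ : ℝ) :
    offCoeff p w ℓ = w / Real.sin (w * ℓ * pieceLength p) := by
  rw [offCoeff, mul_sinSol_eq_sin_div hw, one_div_div]

/-- The derivative of the Dirichlet-to-Neumann matrix along a path of metrics and frequencies. -/
theorem exists_hasDerivAt_dtn (h : Admissible p g w) (hw : 0 < w) (hγ0 : γ 0 = g)
    (hγ : ∀ e, HasDerivAt (fun t => √(γ t e)) (ℓ' e) 0) {ν : ℝ → ℝ} {ν' : ℝ} (hν0 : ν 0 = w)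
    (hν : HasDerivAt ν ν' 0) :
    ∃ D : Matrix (V ⊕ E × Fin p) (V ⊕ E × Fin p) ℝ,
      (∀ u v, HasDerivAt (fun t => G.dtn p (γ t) (ν t) u v) (D u v) 0) ∧
        ∀ c, D.quadForm c = ν' / w * (G.dtn p g w).quadForm c -
          ∑ e, (ℓ' e + ν' / w * √(g e)) * G.nodeEnergy p g w c e := by
  let θ : E → ℝ := fun e => w * √(g e) * pieceLength p
  let θ' : E → ℝ := fun e => (ν' * √(g e) + w * ℓ' e) * pieceLength p
  have hs : ∀ e, Real.sin (θ e) ≠ 0 := sin_piece_ne_zero h hw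
  let P' : E → ℝ := fun e =>
    ν' * Real.cos (θ e) / Real.sin (θ e) - w * θ' e / Real.sin (θ e) ^ 2
  let Q' : E → ℝ := fun e =>
    ν' / Real.sin (θ e) - w * Real.cos (θ e) * θ' e / Real.sin (θ e) ^ 2
  have hne : ∀ᶠ t in 𝓝 0, ν t ≠ 0 :=
    hν.continuousAt.eventually_ne (by rw [hν0]; exact hw.ne')
  have hθ : ∀ e, HasDerivAt (fun t => ν t * √(γ t e) * pieceLength p) (θ' e) 0 := fun e => by
    refine ((hν.fun_mul (hγ e)).mul_const (pieceLength p)).congr_deriv ?_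
    rw [hν0, hγ0]
  have hθ0 : ∀ e, ν 0 * √(γ 0 e) * pieceLength p = θ e := fun e => by rw [hν0, hγ0]
  have hP : ∀ e, HasDerivAt (fun t => diagCoeff p (ν t) √(γ t e)) (P' e) 0 := fun e => by
    have h1 := (hν.fun_mul (hθ e).cos).fun_div (hθ e).sin (by rw [hθ0]; exact hs e)
    refine (h1.congr_of_eventuallyEq (hne.mono fun t ht => diagCoeff_eq ht _)).congr_deriv ?_
    rw [hθ0, hν0]
    have := hs e
    have h2 := Real.sin_sq_add_cos_sq (θ e)
    simp only [P']
    field_simp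
    linear_combination (-w * θ' e) * h2
  have hQ : ∀ e, HasDerivAt (fun t => offCoeff p (ν t) √(γ t e)) (Q' e) 0 := fun e => by
    have h1 := hν.fun_div (hθ e).sin (by rw [hθ0]; exact hs e)
    refine (h1.congr_of_eventuallyEq (hne.mono fun t ht => offCoeff_eq ht _)).congr_deriv ?_
    rw [hθ0, hν0]
    have := hs e
    simp only [Q']
    field_simp
  refine ⟨(G.subdivide p).vertexMatrix (fun q => P' q.1) (fun q => Q' q.1), fun u v => ?_,
    fun c => ?_⟩
  · simp only [dtn, vertexMatrix, Matrix.of_apply]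
    refine HasDerivAt.fun_sum fun q _ => HasDerivAt.fun_add ?_ ?_
    · split_ifs <;> first | exact hasDerivAt_const _ _ |
        exact ((hP q.1).mul_const _).fun_sub ((hQ q.1).mul_const _)
    · split_ifs <;> first | exact hasDerivAt_const _ _ |
        exact ((hP q.1).mul_const _).fun_sub ((hQ q.1).mul_const _)
  -- The prefactor `ν` contributes `ν' / w` times the form. The angle contributes `-w θ' / sin² θ`
  -- times `a² + b² - 2ab cos θ`, and `w θ' = w² (ℓ' + ν' / w * ℓ) * pieceLength p`, which yields
  -- the node energy.
  · rw [vertexMatrix_quadForm, dtn, vertexMatrix_quadForm, Fintype.sum_prod_type,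
      Fintype.sum_prod_type, Finset.mul_sum, ← Finset.sum_sub_distrib]
    refine Finset.sum_congr rfl fun e _ => ?_
    rw [nodeEnergy, Finset.mul_sum, Finset.mul_sum, Finset.mul_sum, ← Finset.sum_sub_distrib]
    refine Finset.sum_congr rfl fun j _ => ?_
    have hse := hs e
    simp only [P', Q', θ', diagCoeff_eq hw.ne', offCoeff_eq hw.ne', θ] at *
    field_simp
    ring

/-- The frequency along a path of metrics for which the frequency times the total length is
`w * L(g) + σ * t`. -/
noncomputable def rescaledFrequency (w : ℝ) (γ : ℝ → E → ℝ) (σ t : ℝ) : ℝ :=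
  (w * totalLength (γ 0) + σ * t) / totalLength (γ t)

theorem rescaledFrequency_zero [Nonempty E] (hg : IsMetric (γ 0)) (σ : ℝ) :
    rescaledFrequency w γ σ 0 = w := by
  have := (totalLength_pos hg).ne'
  rw [rescaledFrequency]
  field_simp
  ring

theorem hasDerivAt_rescaledFrequency [Nonempty E] (hg : IsMetric (γ 0))
    (hγ : ∀ e, HasDerivAt (fun t => √(γ t e)) (ℓ' e) 0) (σ : ℝ) :
    HasDerivAt (rescaledFrequency w γ σ)
      ((σ - w * ∑ e, ℓ' e) / totalLength (γ 0)) 0 := by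
  have hL := totalLength_pos hg
  have h1 : HasDerivAt (fun t => totalLength (γ t)) (∑ e, ℓ' e) 0 :=
    HasDerivAt.fun_sum fun e _ => hγ e
  have h2 : HasDerivAt (fun t : ℝ => w * totalLength (γ 0) + σ * t) σ 0 := by
    simpa using ((hasDerivAt_id' (0 : ℝ)).const_mul σ).const_add (w * totalLength (γ 0))
  refine (h2.fun_div h1 hL.ne').congr_deriv ?_
  have := hL.ne'
  field_simp
  ring

theorem eventually_admissible (h : Admissible p g w) (hw : 0 < w) (hγ0 : γ 0 = g)
    (hγ : ∀ e, HasDerivAt (fun t => √(γ t e)) (ℓ' e) 0) {ν : ℝ → ℝ} (hν0 : ν 0 = w)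
    (hν : ContinuousAt ν 0) : ∀ᶠ t in 𝓝 0, Admissible p (γ t) (ν t) := by
  have h1 : ∀ᶠ t in 𝓝 0, ∀ e, 0 < √(γ t e) := eventually_all.2 fun e =>
    (hγ e).continuousAt.eventually_const_lt (by simpa [hγ0] using h.sqrt_pos e)
  have h2 : ∀ᶠ t in 𝓝 0, 0 < ν t := hν.eventually_const_lt (by rw [hν0]; exact hw)
  have h3 : ∀ᶠ t in 𝓝 0, ∀ e, ν t * √(γ t e) * pieceLength p < Real.pi := by
    refine eventually_all.2 fun e => ?_
    have hc : ContinuousAt (fun t => ν t * √(γ t e) * pieceLength p) 0 :=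
      (hν.mul (hγ e).continuousAt).mul continuousAt_const
    exact hc.eventually_lt_const (by simpa only [hν0, hγ0] using h.lt_pi e)
  filter_upwards [h1, h2, h3] with t h1 h2 h3
  exact ⟨fun e => Real.sqrt_pos.1 (h1 e), h2.le, h3⟩

/-- First-order upper bound for the normalised eigenvalue from a test space. -/
theorem eventually_normalizedEigenvalue_lt [Nonempty E] (hG : G.NoIsolatedVertex)
    (h : Admissible p g w) (hw : 0 < w) (hγ0 : γ 0 = g)
    (hγ : ∀ e, HasDerivAt (fun t => √(γ t e)) (ℓ' e) 0) (σ : ℝ)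
    {j : Fin (Fintype.card (V ⊕ E × Fin p))} {S : Submodule ℝ (V ⊕ E × Fin p → ℝ)}
    (hS : (j : ℕ) + 1 ≤ Module.finrank ℝ S)
    (hS1 : ∀ c ∈ S, c ≠ 0 → (G.dtn p g w).quadForm c ≤ 0)
    (hS2 : ∀ c ∈ S, c ≠ 0 → (G.dtn p g w).quadForm c = 0 →
      0 < ∑ e, (ℓ' e - (∑ e, ℓ' e) / totalLength g * √(g e)) * G.nodeEnergy p g w c e +
        σ / (w * totalLength g) * G.totalEnergy p g w c) :
    ∀ᶠ t in 𝓝[>] 0,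
      G.normalizedEigenvalue j (γ t) < (w * totalLength g + σ * t) ^ 2 := by
  subst hγ0
  have hL := totalLength_pos h.isMetric
  have hν0 := rescaledFrequency_zero (w := w) h.isMetric σ
  have hν := hasDerivAt_rescaledFrequency (w := w) h.isMetric hγ σ
  obtain ⟨D, hD, hDq⟩ := exists_hasDerivAt_dtn (G := G) h hw rfl hγ hν0 hν
  have hΦ0 : G.dtn p (γ 0) (rescaledFrequency w γ σ 0) = G.dtn p (γ 0) w := by rw [hν0]
  have key := Matrix.eventually_quadForm_neg
    (Φ := fun t => G.dtn p (γ t) (rescaledFrequency w γ σ t)) hD (S := S)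
    (fun c hc h0 => by rw [hΦ0]; exact hS1 c hc h0)
    -- Here `ν' / w = σ / (w L) - (∑ ℓ') / L`, so on null vectors the derivative is minus the
    -- expression in `hS2`.
    (fun c hc h0 hq => by
      rw [hΦ0] at hq
      have h1 := hS2 c hc h0 hq
      rw [totalEnergy, Finset.mul_sum, ← Finset.sum_add_distrib] at h1
      rw [hDq, hq, mul_zero, zero_sub, neg_lt_zero]
      refine h1.trans_eq (Finset.sum_congr rfl fun e _ => ?_)
      field_simp
      ring)
  filter_upwards [key, nhdsWithin_le_nhds
    (eventually_admissible h hw rfl hγ hν0 hν.continuousAt)] with t ht hadm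
  have h1 := eigenvalue_lt_sq hG hadm
    ((G.dtn_isHermitian p (γ t) _).sortedEig_neg (i := j) hS ht)
  have hLt := totalLength_pos hadm.isMetric
  have h2 : rescaledFrequency w γ σ t * totalLength (γ t) = w * totalLength (γ 0) + σ * t := by
    rw [rescaledFrequency]
    field_simp
  rw [normalizedEigenvalue, ← h2, mul_pow]
  exact mul_lt_mul_of_pos_right h1 (by positivity)

/-- First-order lower bound for the normalised eigenvalue from a test space. -/
theorem eventually_lt_normalizedEigenvalue [Nonempty E] (hG : G.NoIsolatedVertex) {W : ℝ}
    (h : Admissible p g W) (hw : 0 < w) (hwW : w < W) {e₀ : E}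
    (he₀ : Real.pi / 2 < W * √(g e₀) * pieceLength p) (hγ0 : γ 0 = g)
    (hγ : ∀ e, HasDerivAt (fun t => √(γ t e)) (ℓ' e) 0) (σ : ℝ)
    {j : Fin (Fintype.card (V ⊕ E × Fin p))} (hj : 2 * (j : ℕ) < p)
    {S : Submodule ℝ (V ⊕ E × Fin p → ℝ)}
    (hS : Fintype.card (V ⊕ E × Fin p) - j ≤ Module.finrank ℝ S)
    (hS1 : ∀ c ∈ S, c ≠ 0 → 0 ≤ (G.dtn p g w).quadForm c)
    (hS2 : ∀ c ∈ S, c ≠ 0 → (G.dtn p g w).quadForm c = 0 →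
      ∑ e, (ℓ' e - (∑ e, ℓ' e) / totalLength g * √(g e)) * G.nodeEnergy p g w c e +
        σ / (w * totalLength g) * G.totalEnergy p g w c < 0) :
    ∀ᶠ t in 𝓝[>] 0,
      (w * totalLength g + σ * t) ^ 2 < G.normalizedEigenvalue j (γ t) := by
  subst hγ0
  have hL := totalLength_pos h.isMetric
  have hν0 := rescaledFrequency_zero (w := w) h.isMetric σ
  have hν := hasDerivAt_rescaledFrequency (w := w) h.isMetric hγ σ
  have hadm := h.mono hw.le hwW.le
  obtain ⟨D, hD, hDq⟩ := exists_hasDerivAt_dtn (G := G) hadm hw rfl hγ hν0 hν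
  have hΦ0 : G.dtn p (γ 0) (rescaledFrequency w γ σ 0) = G.dtn p (γ 0) w := by rw [hν0]
  have key := Matrix.eventually_quadForm_pos
    (Φ := fun t => G.dtn p (γ t) (rescaledFrequency w γ σ t)) hD (S := S)
    (fun c hc h0 => by rw [hΦ0]; exact hS1 c hc h0)
    (fun c hc h0 hq => by
      rw [hΦ0] at hq
      have h1 := hS2 c hc h0 hq
      rw [totalEnergy, Finset.mul_sum, ← Finset.sum_add_distrib] at h1
      rw [hDq, hq, mul_zero, zero_sub, neg_pos]
      refine h1.trans_eq' (Finset.sum_congr rfl fun e _ => ?_)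
      field_simp
      ring)
  -- The condition at `W` is open in the metric, so the `j`-th eigenvalue of `γ t` stays below `W²`
  -- and `sq_lt_eigenvalue` applies.
  have hW : ∀ᶠ t in 𝓝 0, Real.pi / 2 < W * √(γ t e₀) * pieceLength p := by
    have hc : ContinuousAt (fun t => W * √(γ t e₀) * pieceLength p) 0 :=
      (continuousAt_const.mul (hγ e₀).continuousAt).mul continuousAt_const
    exact hc.eventually_const_lt he₀
  have hlt : ∀ᶠ t in 𝓝 0, rescaledFrequency w γ σ t < W :=
    hν.continuousAt.eventually_lt_const (by rw [hν0]; exact hwW)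
  filter_upwards [key, nhdsWithin_le_nhds (eventually_admissible hadm hw rfl hγ hν0
    hν.continuousAt), nhdsWithin_le_nhds (eventually_admissible h (hw.trans hwW) rfl hγ
      (ν := fun _ => W) rfl continuousAt_const), nhdsWithin_le_nhds hW,
      nhdsWithin_le_nhds hlt] with t ht hadm hadmW hWt hlt
  have h1 := sq_lt_eigenvalue hG hadmW (dtnEig_neg_of_pi_div_two_lt hG hadmW hWt hj).le
    ⟨hadm.nonneg, hlt.le⟩
    ((G.dtn_isHermitian p (γ t) _).sortedEig_pos (i := j) hS ht)
  have hLt := totalLength_pos hadm.isMetric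
  have h2 : rescaledFrequency w γ σ t * totalLength (γ t) = w * totalLength (γ 0) + σ * t := by
    rw [rescaledFrequency]
    field_simp
  rw [normalizedEigenvalue, ← h2, mul_pow]
  exact mul_lt_mul_of_pos_right h1 (by positivity)

end Perturbation

end QuantumGraph

/-! ### Frequency data and one-sided estimates under a spectral gap. -/

theorem exists_isLittleO_of_eventually_le_mul {H : ℝ → ℝ} (h0 : H 0 ≤ 0)
    (hr : ∀ C > 0, ∀ᶠ t in 𝓝[>] 0, H t ≤ C * t)
    (hl : ∀ C > 0, ∀ᶠ t in 𝓝[>] 0, H (-t) ≤ C * t) :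
    ∃ r : ℝ → ℝ, r =o[𝓝 0] (fun t => t) ∧ ∀ᶠ t in 𝓝 0, H t ≤ r t := by
  -- `H` itself may be very negative; only its positive part is `o(t)`.
  refine ⟨fun t => max (H t) 0, ?_, Eventually.of_forall fun t => le_max_left _ _⟩
  rw [isLittleO_iff]
  intro C hC
  have h1 := eventually_nhdsWithin_iff.1 (hr C hC)
  have h2 := (continuous_neg (G := ℝ)).tendsto' 0 0 neg_zero |>.eventually
    (eventually_nhdsWithin_iff.1 (hl C hC))
  filter_upwards [h1, h2] with t h1 h2
  rw [Real.norm_of_nonneg (le_max_right _ _), Real.norm_eq_abs, max_le_iff]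
  refine ⟨?_, by positivity⟩
  rcases lt_trichotomy t 0 with ht | rfl | ht
  · have := h2 (by simpa using ht)
    rw [neg_neg] at this
    rwa [abs_of_neg ht]
  · simpa using h0
  · rw [abs_of_pos ht]
    exact h1 ht

theorem eventually_sq_add_le {κ : ℝ} (hκ : 0 < κ) {C : ℝ} (hC : 0 < C) :
    ∃ ε > 0, ∀ᶠ t in 𝓝[>] (0 : ℝ),
      (κ + ε * t) ^ 2 ≤ κ ^ 2 + C * t ∧ κ ^ 2 - C * t ≤ (κ + -ε * t) ^ 2 := by
  -- For `ε t ≤ 1` one has `(ε t)² ≤ ε t`, so the increment is at most `(2κ + 1) ε t = C t`.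
  refine ⟨C / (2 * κ + 1), by positivity, ?_⟩
  set ε := C / (2 * κ + 1) with hε
  have hε0 : 0 < ε := by positivity
  have hC' : C = 2 * κ * ε + ε := by
    rw [hε]
    field_simp
  have : Set.Ioo (0 : ℝ) (1 / ε) ∈ 𝓝[>] (0 : ℝ) := Ioo_mem_nhdsGT (by positivity)
  filter_upwards [this] with t ht
  have h1 : ε * t ≤ 1 := by
    have := (lt_div_iff₀ hε0).1 ht.2
    linarith
  have h2 : 0 < ε * t := mul_pos hε0 ht.1
  rw [hC']
  constructor <;> nlinarith

namespace QuantumGraph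

variable {V E : Type*} [Fintype V] [Fintype E] {G : QuantumGraph V E} {p : ℕ} {g : E → ℝ} {w : ℝ}

theorem lt_card_nodes [Nonempty E] {j : ℕ} (hj : j < p) : j < Fintype.card (V ⊕ E × Fin p) := by
  have : 0 < Fintype.card E := Fintype.card_pos
  rw [Fintype.card_sum, Fintype.card_prod, Fintype.card_fin]
  nlinarith

theorem exists_admissible [Nonempty E] (hg : IsMetric g) (p : ℕ) :
    ∃ W e₀, Admissible p g W ∧ Real.pi / 2 < W * √(g e₀) * pieceLength p := by
  obtain ⟨e₀, he₀⟩ := Finite.exists_max fun e => √(g e)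
  have hl := Real.sqrt_pos.2 (hg e₀)
  have hδ := pieceLength_pos p
  have hπ := Real.pi_pos
  have hval : 2 * Real.pi / 3 / (√(g e₀) * pieceLength p) * √(g e₀) * pieceLength p =
      2 * Real.pi / 3 := by
    field_simp
  -- The pieces of the longest edge get the angle `2π/3`, strictly between `π/2` and `π`; all other
  -- angles are no larger.
  refine ⟨2 * Real.pi / 3 / (√(g e₀) * pieceLength p), e₀, ⟨hg, by positivity, fun e => ?_⟩, ?_⟩
  · refine lt_of_le_of_lt (b := 2 * Real.pi / 3) ?_ (by linarith)
    refine le_of_le_of_eq ?_ hval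
    have := he₀ e
    gcongr
  · rw [hval]
    linarith

theorem eigenvalue_eq_sq (hG : G.NoIsolatedVertex) (h : Admissible p g w)
    {j : Fin (Fintype.card (V ⊕ E × Fin p))} (hj : G.dtnEig p g w j = 0) :
    G.eigenvalue j g = w ^ 2 := by
  obtain ⟨z, hz, hz0, heq⟩ := exists_eigenvalue_eq_sq hG h hj.le
  rw [heq, (dtnEig_strictAntiOn hG h j).injOn hz (Set.right_mem_Icc.2 h.nonneg)
    (hz0.trans hj.symm)]

/-- The data attached to the `k`-th eigenvalue: its frequency `w` lies below the bound `W`, and the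
subdivision is fine enough to see the next eigenvalue. -/
structure IsFrequency (G : QuantumGraph V E) (p : ℕ) (g : E → ℝ) (W w : ℝ) (e₀ : E)
    (i : Fin (Fintype.card (V ⊕ E × Fin p))) : Prop where
  admissible : Admissible p g W
  pi_lt : Real.pi / 2 < W * √(g e₀) * pieceLength p
  pos : 0 < w
  lt : w < W
  dtnEig_eq : G.dtnEig p g w i = 0
  index_lt : 2 * ((i : ℕ) + 1) < p

theorem exists_isFrequency [Nonempty E] (hG : G.Connected) {k : ℕ} (hk : 1 ≤ k)
    (hg : IsMetric g) :
    ∃ p W w e₀, ∃ i : Fin (Fintype.card (V ⊕ E × Fin p)),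
      (i : ℕ) = k ∧ G.IsFrequency p g W w e₀ i := by
  -- `2k + 3` is the least `p` with `2(k + 1) < p`.
  obtain ⟨W, e₀, hW, hπ⟩ := exists_admissible hg (2 * k + 3)
  let i : Fin (Fintype.card (V ⊕ E × Fin (2 * k + 3))) := ⟨k, lt_card_nodes (by omega)⟩
  have hneg := dtnEig_neg_of_pi_div_two_lt hG.noIsolatedVertex hW hπ (j := i)
    (by simp only [i]; omega)
  obtain ⟨z, hz, hz0⟩ := exists_dtnEig_eq_zero hW hneg.le
  refine ⟨_, W, z, e₀, i, rfl, hW, hπ, lt_of_le_of_ne hz.1 ?_, lt_of_le_of_ne hz.2 ?_, hz0,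
    by simp only [i]; omega⟩
  · rintro rfl
    exact (dtnEig_zero_pos hG hg (i := i) hk).ne' hz0
  · rintro rfl
    exact hneg.ne hz0

namespace IsFrequency

variable {W : ℝ} {e₀ : E} {i : Fin (Fintype.card (V ⊕ E × Fin p))}

theorem admissible' (hF : G.IsFrequency p g W w e₀ i) : Admissible p g w :=
  hF.admissible.mono hF.pos.le hF.lt.le

theorem eigenvalue_eq (hF : G.IsFrequency p g W w e₀ i) (hG : G.NoIsolatedVertex) :
    G.eigenvalue i g = w ^ 2 := eigenvalue_eq_sq hG hF.admissible' hF.dtnEig_eq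

theorem normalizedEigenvalue_eq (hF : G.IsFrequency p g W w e₀ i) (hG : G.NoIsolatedVertex) :
    G.normalizedEigenvalue i g = (w * totalLength g) ^ 2 := by
  rw [normalizedEigenvalue, hF.eigenvalue_eq hG, mul_pow]

/-- Since densities are constant on edges, the pointwise condition reduces to one equation per edge
in the node values. -/
theorem hasUnitEnergy_of_sum_nodeEnergy (hF : G.IsFrequency p g W w e₀ i)
    (hG : G.NoIsolatedVertex) {ι : Type*} [Fintype ι] (c : ι → V ⊕ E × Fin p → ℝ)
    (hker : ∀ l, (G.dtn p g w).mulVec (c l) = 0) (hne : ∀ l, c l ≠ 0)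
    (hsum : ∀ e, ∑ l, G.nodeEnergy p g w (c l) e = 1) : G.HasUnitEnergyEigenfunctions i g := by
  let φ := (Fintype.equivFin ι).symm
  refine ⟨Fintype.card ι, fun l => G.reconstruct p g w (c (φ l)), fun l => ?_, fun e x => ?_⟩
  · rw [hF.eigenvalue_eq hG]
    exact ⟨solves_reconstruct hF.admissible' (hker _), fun h0 =>
      hne _ (eq_zero_of_reconstruct_eq_zero hG hF.admissible' (hker _) h0)⟩
  · rw [hF.eigenvalue_eq hG, Finset.sum_congr rfl fun l _ =>
      energy_reconstruct hF.admissible' hF.pos (hker (φ l)) e x,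
      φ.sum_comp fun l => G.nodeEnergy p g w (c l) e]
    exact hsum e

theorem exists_sum_nodeEnergy (hF : G.IsFrequency p g W w e₀ i)
    (hG : G.NoIsolatedVertex) (hU : G.HasUnitEnergyEigenfunctions i g) :
    ∃ (n : ℕ) (c : Fin n → V ⊕ E × Fin p → ℝ), (∀ l, (G.dtn p g w).mulVec (c l) = 0) ∧
      (∀ l, c l ≠ 0) ∧ ∀ e, ∑ l, G.nodeEnergy p g w (c l) e = 1 := by
  obtain ⟨n, f, hf, hsum⟩ := hU
  rw [hF.eigenvalue_eq hG] at hf hsum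
  choose c hc hcf using fun l => exists_mulVec_eq_zero_of_solves hF.admissible' (hf l).1
  refine ⟨n, c, hc, fun l h0 => (hf l).2 ?_, fun e => ?_⟩
  · rw [← hcf, h0, map_zero]
  · rw [← hsum e 0]
    refine Finset.sum_congr rfl fun l _ => ?_
    rw [← energy_reconstruct hF.admissible' hF.pos (hc l) e 0, hcf]

/-- The gap below makes the form negative definite on the low span of index `i - 1`. Adding the
kernel vector `f` gives dimension `i + 1` and a nonpositive form whose null vectors are multiples of
`f`. Along `f` the direction does not raise the eigenvalue, and `ε > 0` makes the derivative
strictly negative. -/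
theorem eventually_lt_of_direction [Nonempty E] (hF : G.IsFrequency p g W w e₀ i)
    (hG : G.NoIsolatedVertex) (hgap : G.eigenvalue ((i : ℕ) - 1) g < G.eigenvalue i g)
    (hi : 1 ≤ (i : ℕ))
    {γ : ℝ → E → ℝ} {ℓ' : E → ℝ} (hγ0 : γ 0 = g)
    (hγ : ∀ e, HasDerivAt (fun t => √(γ t e)) (ℓ' e) 0) {f : V ⊕ E × Fin p → ℝ} (hf0 : f ≠ 0)
    (hf : (G.dtn p g w).mulVec f = 0)
    (hdir : 0 ≤ ∑ e, (ℓ' e - (∑ e, ℓ' e) / totalLength g * √(g e)) * G.nodeEnergy p g w f e)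
    {ε : ℝ} (hε : 0 < ε) :
    ∀ᶠ t in 𝓝[>] 0, G.normalizedEigenvalue i (γ t) < (w * totalLength g + ε * t) ^ 2 := by
  have hL := totalLength_pos hF.admissible.isMetric
  have hM := G.dtn_isHermitian p g w
  have hq0 : (G.dtn p g w).quadForm f = 0 := by simp [Matrix.quadForm, hf]
  let i' : Fin (Fintype.card (V ⊕ E × Fin p)) := ⟨(i : ℕ) - 1, by omega⟩
  have hneg : G.dtnEig p g w i' < 0 := by
    by_contra! hle
    rcases hle.eq_or_lt with heq | hlt
    · have := eigenvalue_eq_sq hG hF.admissible' heq.symm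
      rw [hF.eigenvalue_eq hG, this] at hgap
      exact lt_irrefl _ hgap
    · have := sq_lt_eigenvalue hG hF.admissible (dtnEig_neg_of_pi_div_two_lt hG hF.admissible
        hF.pi_lt (j := i') (by have := hF.index_lt; simp only [i']; omega)).le
        ⟨hF.pos.le, hF.lt.le⟩ hlt
      rw [hF.eigenvalue_eq hG] at hgap
      exact lt_asymm hgap this
  have hlow : ∀ u ∈ hM.lowSpan i', u ≠ 0 → (G.dtn p g w).quadForm u < 0 := fun u hu hu0 =>
    (hM.quadForm_le_of_mem_lowSpan hu).trans_lt
      (mul_neg_of_neg_of_pos hneg (Matrix.dotProduct_self_pos hu0))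
  have hle : ∀ u ∈ hM.lowSpan i', (G.dtn p g w).quadForm u ≤ 0 := fun u hu => by
    rcases eq_or_ne u 0 with rfl | hu0
    · simp [Matrix.quadForm]
    · exact (hlow u hu hu0).le
  have hfS : f ∉ hM.lowSpan i' := fun hfS => (hlow f hfS hf0).ne hq0
  have hdec : ∀ c ∈ hM.lowSpan i' ⊔ Submodule.span ℝ {f}, ∃ u ∈ hM.lowSpan i', ∃ a : ℝ,
      c = u + a • f ∧ (G.dtn p g w).quadForm c = (G.dtn p g w).quadForm u := by
    intro c hc
    obtain ⟨u, hu, y, hy, rfl⟩ := Submodule.mem_sup.1 hc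
    obtain ⟨a, rfl⟩ := Submodule.mem_span_singleton.1 hy
    exact ⟨u, hu, a, rfl, Matrix.quadForm_add_of_mulVec_eq_zero hM
      (by rw [Matrix.mulVec_smul, hf, smul_zero])⟩
  refine eventually_normalizedEigenvalue_lt hG hF.admissible' hF.pos hγ0 hγ ε
    (S := hM.lowSpan i' ⊔ Submodule.span ℝ {f}) ?_ ?_ ?_
  · have := Matrix.add_one_le_finrank_sup_span hfS
    rw [hM.finrank_lowSpan] at this
    have hi' : (i' : ℕ) = i - 1 := rfl
    omega
  · intro c hc _
    obtain ⟨u, hu, a, rfl, hq⟩ := hdec c hc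
    rw [hq]
    exact hle u hu
  · intro c hc hc0 hcq
    obtain ⟨u, hu, a, rfl, hq⟩ := hdec c hc
    have hu0 : u = 0 := by
      by_contra hne
      exact (hlow u hu hne).ne (hq.symm.trans hcq)
    rw [hu0, zero_add] at hc0 ⊢
    have h1 := totalEnergy_pos hG hF.admissible' hF.pos hc0
    have h2 : ∑ e, (ℓ' e - (∑ e, ℓ' e) / totalLength g * √(g e)) *
        G.nodeEnergy p g w (a • f) e = a ^ 2 * ∑ e, (ℓ' e - (∑ e, ℓ' e) / totalLength g *
          √(g e)) * G.nodeEnergy p g w f e := by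
      rw [Finset.mul_sum]
      exact Finset.sum_congr rfl fun e _ => by rw [nodeEnergy_smul]; ring
    rw [h2]
    have h3 := hF.pos
    have : 0 ≤ a ^ 2 * ∑ e, (ℓ' e - (∑ e, ℓ' e) / totalLength g *
          √(g e)) * G.nodeEnergy p g w f e := mul_nonneg (sq_nonneg a) hdir
    positivity

/-- The mirror image: the gap above makes the form positive definite on the high span of index `i +
1`, and `f` supplies the one missing dimension. -/
theorem eventually_gt_of_direction [Nonempty E] (hF : G.IsFrequency p g W w e₀ i)
    (hG : G.NoIsolatedVertex) (hgap : G.eigenvalue i g < G.eigenvalue ((i : ℕ) + 1) g)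
    {γ : ℝ → E → ℝ} {ℓ' : E → ℝ} (hγ0 : γ 0 = g)
    (hγ : ∀ e, HasDerivAt (fun t => √(γ t e)) (ℓ' e) 0) {f : V ⊕ E × Fin p → ℝ} (hf0 : f ≠ 0)
    (hf : (G.dtn p g w).mulVec f = 0)
    (hdir : ∑ e, (ℓ' e - (∑ e, ℓ' e) / totalLength g * √(g e)) * G.nodeEnergy p g w f e ≤ 0)
    {ε : ℝ} (hε : 0 < ε) :
    ∀ᶠ t in 𝓝[>] 0, (w * totalLength g + -ε * t) ^ 2 < G.normalizedEigenvalue i (γ t) := by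
  have hL := totalLength_pos hF.admissible.isMetric
  have hM := G.dtn_isHermitian p g w
  have hq0 : (G.dtn p g w).quadForm f = 0 := by simp [Matrix.quadForm, hf]
  let i' : Fin (Fintype.card (V ⊕ E × Fin p)) :=
    ⟨(i : ℕ) + 1, lt_card_nodes (by have := hF.index_lt; omega)⟩
  have hpos : 0 < G.dtnEig p g w i' := by
    by_contra! hle
    obtain ⟨z, hz, -, heq⟩ := exists_eigenvalue_eq_sq hG hF.admissible' hle
    have : G.eigenvalue ((i : ℕ) + 1) g = z ^ 2 := heq
    rw [hF.eigenvalue_eq hG, this] at hgap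
    exact hgap.not_ge (pow_le_pow_left₀ hz.1 hz.2 2)
  have hhigh : ∀ u ∈ hM.highSpan i', u ≠ 0 → 0 < (G.dtn p g w).quadForm u := fun u hu hu0 =>
    (mul_pos hpos (Matrix.dotProduct_self_pos hu0)).trans_le (hM.le_quadForm_of_mem_highSpan hu)
  have hle : ∀ u ∈ hM.highSpan i', 0 ≤ (G.dtn p g w).quadForm u := fun u hu => by
    rcases eq_or_ne u 0 with rfl | hu0
    · simp [Matrix.quadForm]
    · exact (hhigh u hu hu0).le
  have hfS : f ∉ hM.highSpan i' := fun hfS => (hhigh f hfS hf0).ne' hq0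
  have hdec : ∀ c ∈ hM.highSpan i' ⊔ Submodule.span ℝ {f}, ∃ u ∈ hM.highSpan i', ∃ a : ℝ,
      c = u + a • f ∧ (G.dtn p g w).quadForm c = (G.dtn p g w).quadForm u := by
    intro c hc
    obtain ⟨u, hu, y, hy, rfl⟩ := Submodule.mem_sup.1 hc
    obtain ⟨a, rfl⟩ := Submodule.mem_span_singleton.1 hy
    exact ⟨u, hu, a, rfl, Matrix.quadForm_add_of_mulVec_eq_zero hM
      (by rw [Matrix.mulVec_smul, hf, smul_zero])⟩
  refine eventually_lt_normalizedEigenvalue hG hF.admissible hF.pos hF.lt hF.pi_lt hγ0 hγ (-ε)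
    (S := hM.highSpan i' ⊔ Submodule.span ℝ {f}) (by have := hF.index_lt; omega) ?_ ?_ ?_
  · have := Matrix.add_one_le_finrank_sup_span hfS
    rw [hM.finrank_highSpan] at this
    have hi' : (i' : ℕ) = i + 1 := rfl
    have hlt := i'.2
    omega
  · intro c hc _
    obtain ⟨u, hu, a, rfl, hq⟩ := hdec c hc
    rw [hq]
    exact hle u hu
  · intro c hc hc0 hcq
    obtain ⟨u, hu, a, rfl, hq⟩ := hdec c hc
    have hu0 : u = 0 := by
      by_contra hne
      exact (hhigh u hu hne).ne' (hq.symm.trans hcq)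
    rw [hu0, zero_add] at hc0 ⊢
    have h1 := totalEnergy_pos hG hF.admissible' hF.pos hc0
    have h2 : ∑ e, (ℓ' e - (∑ e, ℓ' e) / totalLength g * √(g e)) *
        G.nodeEnergy p g w (a • f) e = a ^ 2 * ∑ e, (ℓ' e - (∑ e, ℓ' e) / totalLength g *
          √(g e)) * G.nodeEnergy p g w f e := by
      rw [Finset.mul_sum]
      exact Finset.sum_congr rfl fun e _ => by rw [nodeEnergy_smul]; ring
    rw [h2]
    have h3 := hF.pos
    have h4 : a ^ 2 * ∑ e, (ℓ' e - (∑ e, ℓ' e) / totalLength g *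
          √(g e)) * G.nodeEnergy p g w f e ≤ 0 :=
      mul_nonpos_of_nonneg_of_nonpos (sq_nonneg a) hdir
    have h5 : 0 < ε / (w * totalLength g) * G.totalEnergy p g w (a • f) := by positivity
    rw [neg_div, neg_mul]
    linarith

end IsFrequency

/-! ### Unit energy implies extremality. -/

/-- The two directions of a path through a metric. -/
theorem hasDerivAt_sqrt_reflect {γ : ℝ → E → ℝ} {ℓ' : E → ℝ}
    (hγ : ∀ e, HasDerivAt (fun t => √(γ t e)) (ℓ' e) 0) (e : E) :
    HasDerivAt (fun t => √(γ (-t) e)) (-ℓ' e) 0 := by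
  have h1 : HasDerivAt (fun t => √(γ t e)) (ℓ' e) (-0) := by
    rw [neg_zero]
    exact hγ e
  have := h1.scomp (0 : ℝ) (hasDerivAt_neg (0 : ℝ))
  simpa [Function.comp_def] using this

theorem exists_hasDerivAt_sqrt {γ : ℝ → E → ℝ} {ε : ℝ} (hε : 0 < ε)
    (hγ : ContDiffOn ℝ ∞ γ (Set.Ioo (-ε) ε)) (hγ0 : IsMetric (γ 0)) (e : E) :
    ∃ ℓ', HasDerivAt (fun t => √(γ t e)) ℓ' 0 := by
  have h1 : DifferentiableAt ℝ γ 0 :=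
    (hγ.contDiffAt (Ioo_mem_nhds (neg_neg_of_pos hε) hε)).differentiableAt (by simp)
  have h2 : DifferentiableAt ℝ (fun t => γ t e) 0 := differentiableAt_pi.1 h1 e
  exact ⟨_, (h2.sqrt (hγ0 e).ne').hasDerivAt⟩

/-- Summed over `l` the expressions give `∑ ℓ' - ((∑ ℓ') / L) L = 0`, so they cannot all be
negative. -/
theorem exists_direction {n : ℕ} {c : Fin n → V ⊕ E × Fin p → ℝ} [Nonempty E]
    (hg : IsMetric g) (hsum : ∀ e, ∑ l, G.nodeEnergy p g w (c l) e = 1) (ℓ' : E → ℝ) :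
    ∃ l, 0 ≤ ∑ e, (ℓ' e - (∑ e, ℓ' e) / totalLength g * √(g e)) * G.nodeEnergy p g w (c l) e := by
  by_contra! hneg
  have hL := (totalLength_pos hg).ne'
  have hn : (Finset.univ : Finset (Fin n)).Nonempty := by
    obtain ⟨e⟩ := ‹Nonempty E›
    by_contra h0
    rw [Finset.not_nonempty_iff_eq_empty] at h0
    have := hsum e
    rw [h0] at this
    simp at this
  have h1 := Finset.sum_lt_sum_of_nonempty hn fun l _ => hneg l
  rw [Finset.sum_comm] at h1
  simp only [← Finset.mul_sum, hsum, mul_one, Finset.sum_sub_distrib, Finset.sum_const_zero] at h1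
  rw [show ∑ e, √(g e) = totalLength g from rfl, div_mul_cancel₀ _ hL, sub_self] at h1
  exact lt_irrefl _ h1

/-- A gap below gives the upper estimate, a gap above the lower one. Negative times are handled by
the reflected path, for which a different `c l` may serve. -/
theorem isExtremal_of_hasUnitEnergy [Nonempty E] (hG : G.Connected) {k : ℕ} (hk : 1 ≤ k)
    (hg : IsMetric g) (hU : G.HasUnitEnergyEigenfunctions k g)
    (hgap : G.eigenvalue (k - 1) g < G.eigenvalue k g ∨
      G.eigenvalue k g < G.eigenvalue (k + 1) g) :
    IsExtremal (G.normalizedEigenvalue k) g := by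
  obtain ⟨p, W, w, e₀, i, rfl, hF⟩ := exists_isFrequency hG hk hg
  have hG' := hG.noIsolatedVertex
  obtain ⟨n, c, hker, hne, hsum⟩ := hF.exists_sum_nodeEnergy hG' hU
  have hL := totalLength_pos hg
  have hκ : 0 < w * totalLength g := mul_pos hF.pos hL
  intro ε γ hε hγ _ hγ0
  choose ℓ' hℓ' using exists_hasDerivAt_sqrt hε hγ (hγ0 ▸ hg)
  have hF0 := hF.normalizedEigenvalue_eq hG'
  rcases hgap with hgap | hgap
  · left
    have key : ∀ (γ : ℝ → E → ℝ) (ℓ' : E → ℝ), γ 0 = g →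
        (∀ e, HasDerivAt (fun t => √(γ t e)) (ℓ' e) 0) → ∀ C > 0, ∀ᶠ t in 𝓝[>] 0,
        G.normalizedEigenvalue i (γ t) - G.normalizedEigenvalue i g ≤ C * t := by
      intro γ ℓ' hγ0 hγ C hC
      obtain ⟨l, hl⟩ := exists_direction hg hsum ℓ'
      obtain ⟨η, hη, hev⟩ := eventually_sq_add_le hκ hC
      filter_upwards [hev, hF.eventually_lt_of_direction hG' hgap hk hγ0 hγ (hne l) (hker l) hl hη]
        with t h1 h2
      rw [hF0]
      linarith [h1.1]
    obtain ⟨r, hr, hle⟩ := exists_isLittleO_of_eventually_le_mul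
      (H := fun t => G.normalizedEigenvalue i (γ t) - G.normalizedEigenvalue i g)
      (by simp [hγ0]) (key γ ℓ' hγ0 hℓ')
      (key (fun t => γ (-t)) (fun e => -ℓ' e) (by simpa using hγ0) (hasDerivAt_sqrt_reflect hℓ'))
    exact ⟨r, hr, hle.mono fun t ht => by linarith⟩
  · right
    have key : ∀ (γ : ℝ → E → ℝ) (ℓ' : E → ℝ), γ 0 = g →
        (∀ e, HasDerivAt (fun t => √(γ t e)) (ℓ' e) 0) → ∀ C > 0, ∀ᶠ t in 𝓝[>] 0,
        G.normalizedEigenvalue i g - G.normalizedEigenvalue i (γ t) ≤ C * t := by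
      intro γ ℓ' hγ0 hγ C hC
      obtain ⟨l, hl⟩ := exists_direction hg hsum fun e => -ℓ' e
      have hl' : ∑ e, (ℓ' e - (∑ e, ℓ' e) / totalLength g * √(g e)) *
          G.nodeEnergy p g w (c l) e ≤ 0 := by
        rw [← neg_nonneg, ← Finset.sum_neg_distrib]
        refine hl.trans_eq (Finset.sum_congr rfl fun e _ => ?_)
        rw [Finset.sum_neg_distrib]
        ring
      obtain ⟨η, hη, hev⟩ := eventually_sq_add_le hκ hC
      filter_upwards [hev, hF.eventually_gt_of_direction hG' hgap hγ0 hγ (hne l) (hker l) hl' hη]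
        with t h1 h2
      rw [hF0]
      linarith [h1.2]
    obtain ⟨r, hr, hle⟩ := exists_isLittleO_of_eventually_le_mul
      (H := fun t => G.normalizedEigenvalue i g - G.normalizedEigenvalue i (γ t))
      (by simp [hγ0]) (key γ ℓ' hγ0 hℓ')
      (key (fun t => γ (-t)) (fun e => -ℓ' e) (by simpa using hγ0) (hasDerivAt_sqrt_reflect hℓ'))
    refine ⟨fun t => -r t, hr.neg_left, hle.mono fun t ht => by linarith⟩

/-! ### Extremality implies unit energy. -/

/-- Separation: without eigenfunctions of unit energy density there is a direction of metrics along
which all branches of the eigenvalue decrease. -/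
theorem exists_definite_direction [Nonempty E] {W : ℝ} {e₀ : E}
    {i : Fin (Fintype.card (V ⊕ E × Fin p))} (hF : G.IsFrequency p g W w e₀ i)
    (hG : G.NoIsolatedVertex) (hU : ¬ G.HasUnitEnergyEigenfunctions i g) :
    ∃ (v : E → ℝ) (η : ℝ), 0 < η ∧ ∑ e, v e = 0 ∧
      ∀ c, c ≠ 0 → (G.dtn p g w).mulVec c = 0 →
        η * G.totalEnergy p g w c < ∑ e, v e * G.nodeEnergy p g w c e := by
  classical
  have hL := totalLength_pos hF.admissible.isMetric
  have hT : ∀ c, c ≠ 0 → 0 < G.totalEnergy p g w c :=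
    fun c hc => totalEnergy_pos hG hF.admissible' hF.pos hc
  let K : Set (V ⊕ E × Fin p → ℝ) :=
    (LinearMap.ker (G.dtn p g w).mulVecLin : Set _) ∩ Metric.sphere 0 1
  have hK : IsCompact K := (isCompact_sphere 0 1).inter_left
    (LinearMap.ker (G.dtn p g w).mulVecLin).closed_of_finiteDimensional
  have hKne : ∀ c ∈ K, c ≠ 0 := by
    rintro c ⟨-, hc⟩ rfl
    simp at hc
  have hKker : ∀ c ∈ K, (G.dtn p g w).mulVec c = 0 := fun c hc => by simpa using hc.1
  -- The normalisation gives `∑ ℓ_e ρ_e = L`, as for the constant vector 1.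
  let ρ : (V ⊕ E × Fin p → ℝ) → E → ℝ :=
    fun c e => totalLength g * G.nodeEnergy p g w c e / G.totalEnergy p g w c
  have hρ : ContinuousOn ρ K := continuousOn_pi.2 fun e =>
    ContinuousOn.div (continuous_const.mul (continuous_nodeEnergy e)).continuousOn
      continuous_totalEnergy.continuousOn fun c hc => (hT c (hKne c hc)).ne'
  have hH := (hK.image_of_continuousOn hρ).convexHull_of_finiteDimensional
  have hnot : (fun _ => (1 : ℝ)) ∉ convexHull ℝ (ρ '' K) := by
    intro hmem
    obtain ⟨ι, _, z, a, hz, -, ha, -, hsum⟩ := eq_pos_convex_span_of_mem_convexHull hmem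
    choose c hc hcz using fun l => hz ⟨l, rfl⟩
    have hpos : ∀ l, 0 < a l * totalLength g / G.totalEnergy p g w (c l) := fun l =>
      div_pos (mul_pos (ha l) hL) (hT _ (hKne _ (hc l)))
    -- Energies are quadratic, so the convex weights enter the eigenfunctions through square roots.
    refine hU (hF.hasUnitEnergy_of_sum_nodeEnergy hG
      (fun l => √(a l * totalLength g / G.totalEnergy p g w (c l)) • c l) (fun l => ?_)
      (fun l => smul_ne_zero (Real.sqrt_pos.2 (hpos l)).ne' (hKne _ (hc l))) fun e => ?_)
    · rw [Matrix.mulVec_smul, hKker _ (hc l), smul_zero]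
    · have h1 := congrFun hsum e
      rw [Finset.sum_apply] at h1
      rw [← h1]
      refine Finset.sum_congr rfl fun l _ => ?_
      rw [nodeEnergy_smul, Real.sq_sqrt (hpos l).le, ← hcz]
      simp only [Pi.smul_apply, smul_eq_mul, ρ]
      ring
  obtain ⟨φ, u, hu1, hu2⟩ := geometric_hahn_banach_point_closed (convex_convexHull ℝ _)
    hH.isClosed hnot
  let y : E → ℝ := fun e => φ (Pi.single e 1)
  have hφ : ∀ x : E → ℝ, φ x = ∑ e, y e * x e := fun x => by
    have := LinearMap.pi_apply_eq_sum_univ φ.toLinearMap x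
    simp only [ContinuousLinearMap.coe_coe, smul_eq_mul] at this
    rw [this]
    refine Finset.sum_congr rfl fun e _ => ?_
    rw [mul_comm]
    congr 2
    ext e'
    simp [Pi.single_apply, eq_comm]
  have hφ1 : φ (fun _ => 1) = ∑ e, y e := by simp [hφ]
  rw [hφ1] at hu1
  -- Subtracting a multiple of the length vector makes the sum zero and lowers the pairing by a
  -- multiple of the total energy; the gap `u - φ(1)` in the separation leaves the margin `η`.
  refine ⟨fun e => y e - (∑ e, y e) / totalLength g * √(g e), (u - ∑ e, y e) / totalLength g,
    div_pos (by linarith) hL, ?_, ?_⟩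
  · rw [Finset.sum_sub_distrib, ← Finset.mul_sum, show ∑ e, √(g e) = totalLength g from rfl,
      div_mul_cancel₀ _ hL.ne', sub_self]
  · have hunit : ∀ c ∈ K, (u - ∑ e, y e) / totalLength g * G.totalEnergy p g w c <
        ∑ e, (y e - (∑ e, y e) / totalLength g * √(g e)) * G.nodeEnergy p g w c e := by
      intro c hc
      have h1 := hu2 _ (subset_convexHull ℝ _ ⟨c, hc, rfl⟩)
      have hTc := hT c (hKne c hc)
      have h2 : φ (ρ c) = totalLength g / G.totalEnergy p g w c *
          ∑ e, y e * G.nodeEnergy p g w c e := by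
        rw [hφ, Finset.mul_sum]
        exact Finset.sum_congr rfl fun e _ => by simp only [ρ]; ring
      have h3 : ∑ e, (y e - (∑ e, y e) / totalLength g * √(g e)) * G.nodeEnergy p g w c e =
          ∑ e, y e * G.nodeEnergy p g w c e -
            (∑ e, y e) / totalLength g * G.totalEnergy p g w c := by
        rw [totalEnergy, Finset.mul_sum, ← Finset.sum_sub_distrib]
        exact Finset.sum_congr rfl fun e _ => by ring
      rw [h2, div_mul_eq_mul_div, lt_div_iff₀ hTc] at h1
      rw [h3, sub_div, sub_mul]
      have h4 : u / totalLength g * G.totalEnergy p g w c <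
          ∑ e, y e * G.nodeEnergy p g w c e := by
        rw [div_mul_eq_mul_div, div_lt_iff₀ hL]
        linarith
      linarith
    intro c hc hker
    have hn : 0 < ‖c‖ := norm_pos_iff.2 hc
    have h1 := hunit (‖c‖⁻¹ • c) ⟨by simp [hker],
      by simp [norm_smul, hn.ne']⟩
    rw [totalEnergy_smul] at h1
    simp only [nodeEnergy_smul] at h1
    have h2 : 0 < ‖c‖⁻¹ ^ 2 := by positivity
    refine lt_of_mul_lt_mul_left ?_ h2.le
    rw [Finset.mul_sum, mul_left_comm]
    exact h1.trans_eq (Finset.sum_congr rfl fun e _ => by ring)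

theorem hasUnitEnergy_of_isExtremal [Nonempty E] (hG : G.Connected) {k : ℕ} (hk : 1 ≤ k)
    (hg : IsMetric g) (hext : IsExtremal (G.normalizedEigenvalue k) g) :
    G.HasUnitEnergyEigenfunctions k g := by
  obtain ⟨p, W, w, e₀, i, rfl, hF⟩ := exists_isFrequency hG hk hg
  have hG' := hG.noIsolatedVertex
  by_contra hU
  obtain ⟨v, η₀, hη₀, hv, hdef⟩ := exists_definite_direction hF hG' hU
  have hL := totalLength_pos hg
  have hκ : 0 < w * totalLength g := mul_pos hF.pos hL
  set κ := w * totalLength g with hκdef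
  let η := η₀ * κ
  have hη : 0 < η := mul_pos hη₀ hκ
  have hM := G.dtn_isHermitian p g w
  have hF0 := hF.normalizedEigenvalue_eq hG'
  -- The lengths move linearly with velocity `v`, so the total length is constant near `t = 0`.
  let γ : ℝ → E → ℝ := fun t e => (√(g e) + t * v e) ^ 2
  have hγ0 : γ 0 = g := by
    funext e
    simp [γ, Real.sq_sqrt (hg e).le]
  have hpos : ∀ᶠ t : ℝ in 𝓝 0, ∀ e, 0 < √(g e) + t * v e := eventually_all.2 fun e => by
    have hc : ContinuousAt (fun t : ℝ => √(g e) + t * v e) 0 := by fun_prop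
    exact hc.eventually_const_lt (by simpa using hg e)
  have hγ : ∀ e, HasDerivAt (fun t => √(γ t e)) (v e) 0 := fun e => by
    have h1 : HasDerivAt (fun t : ℝ => √(g e) + t * v e) (v e) 0 := by
      simpa using ((hasDerivAt_id' (0 : ℝ)).mul_const (v e)).const_add (√(g e))
    exact h1.congr_of_eventuallyEq (hpos.mono fun t ht => Real.sqrt_sq (ht e).le)
  -- `sortedEig i = 0`, so the form is nonpositive on `lowSpan i` and its null vectors there are
  -- kernel vectors, on which `v` is definite. `hlow` is the dual argument on `highSpan i` for the
  -- reversed path.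
  have hup := eventually_normalizedEigenvalue_lt hG' hF.admissible' hF.pos hγ0 hγ (-η)
    (S := hM.lowSpan i) (hM.finrank_lowSpan i).ge
    (fun c hc _ => by
      have := hM.quadForm_le_of_mem_lowSpan hc
      rwa [show hM.sortedEig i = 0 from hF.dtnEig_eq, zero_mul] at this)
    (fun c hc hc0 hq => by
      have h1 := hdef c hc0 (hM.mulVec_eq_zero_of_mem_lowSpan hF.dtnEig_eq.le hc hq)
      rw [hv]
      simp only [zero_div, zero_mul, sub_zero]
      have h2 : -η / (w * totalLength g) = -η₀ := by
        rw [← hκdef]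
        simp only [η]
        field_simp
      rw [h2]
      linarith)
  have hlow := eventually_lt_normalizedEigenvalue hG' hF.admissible hF.pos hF.lt hF.pi_lt
    (γ := fun t => γ (-t)) (by simpa using hγ0) (hasDerivAt_sqrt_reflect hγ) η (j := i)
    (by have := hF.index_lt; omega) (S := hM.highSpan i) (hM.finrank_highSpan i).ge
    (fun c hc _ => by
      have := hM.le_quadForm_of_mem_highSpan hc
      rwa [show hM.sortedEig i = 0 from hF.dtnEig_eq, zero_mul] at this)
    (fun c hc hc0 hq => by
      have h1 := hdef c hc0 (hM.mulVec_eq_zero_of_mem_highSpan hF.dtnEig_eq.ge hc hq)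
      rw [Finset.sum_neg_distrib, hv]
      simp only [neg_zero, zero_div, zero_mul, sub_zero, neg_mul, Finset.sum_neg_distrib]
      have h2 : η / (w * totalLength g) = η₀ := by
        rw [← hκdef]
        simp only [η]
        field_simp
      rw [h2]
      linarith)
  obtain ⟨ε, hε, hball⟩ := Metric.eventually_nhds_iff.1 hpos
  have hsmooth : ContDiffOn ℝ ∞ γ (Set.Ioo (-ε) ε) := by
    refine ContDiff.contDiffOn (contDiff_pi.2 fun e => ?_)
    fun_prop
  have hmetric : ∀ t ∈ Set.Ioo (-ε) ε, IsMetric (γ t) := fun t ht e => by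
    have := hball (y := t) (by rw [Real.dist_eq, sub_zero, abs_lt]; exact ht) e
    simp only [γ]
    positivity
  have hneg : Tendsto (fun t : ℝ => -t) (𝓝[>] 0) (𝓝 0) :=
    ((continuous_neg (G := ℝ)).tendsto' 0 0 neg_zero).mono_left nhdsWithin_le_nhds
  -- Forward the value is below `(κ - η t)² < κ² - κ η t` once `η t < κ`; backward it exceeds `(κ +
  -- η t)² ≥ κ² + 2 κ η t`. An `o(t)` error compensates neither.
  rcases hext ε γ hε hsmooth hmetric hγ0 with ⟨r, hr, hle⟩ | ⟨r, hr, hle⟩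
  · have hb := isLittleO_iff.1 hr (mul_pos hκ hη)
    obtain ⟨t, h1, h2, h3, ht⟩ := (hlow.and ((hneg.eventually hle).and
      ((hneg.eventually hb).and self_mem_nhdsWithin))).exists
    rw [hF0] at h2
    rw [norm_neg, Real.norm_eq_abs, Real.norm_of_nonneg (le_of_lt ht)] at h3
    have h4 := (abs_le.1 h3).2
    have ht' : 0 < t := ht
    have h5 : 0 < κ * η * t := by positivity
    have h6 : 0 ≤ (η * t) ^ 2 := sq_nonneg _
    nlinarith
  · have hb := isLittleO_iff.1 hr (c := κ * η / 2) (by positivity)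
    have hsmall : Set.Ioo (0 : ℝ) (κ / η) ∈ 𝓝[>] (0 : ℝ) := Ioo_mem_nhdsGT (by positivity)
    obtain ⟨t, h1, h2, h3, ht⟩ := (hup.and ((hle.filter_mono nhdsWithin_le_nhds).and
      ((hb.filter_mono nhdsWithin_le_nhds).and hsmall))).exists
    rw [hF0] at h2
    rw [Real.norm_eq_abs, Real.norm_of_nonneg ht.1.le] at h3
    have h4 := (abs_le.1 h3).1
    have h5 : η * t < κ := by
      have := (lt_div_iff₀ hη).1 ht.2
      linarith
    have h6 : 0 < η * t := mul_pos hη ht.1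
    nlinarith

end QuantumGraph

theorem theorem1p1 {V E : Type*} [Fintype V] [Fintype E] [Nonempty E]
    (G : QuantumGraph V E) (hG : G.Connected) (k : ℕ) (hk : 1 ≤ k)
    (g : E → ℝ) (hg : QuantumGraph.IsMetric g) :
    (QuantumGraph.IsExtremal (G.normalizedEigenvalue k) g → G.HasUnitEnergyEigenfunctions k g) ∧
    (G.HasUnitEnergyEigenfunctions k g →
      (G.eigenvalue (k - 1) g < G.eigenvalue k g ∨ G.eigenvalue k g < G.eigenvalue (k + 1) g) →
      QuantumGraph.IsExtremal (G.normalizedEigenvalue k) g) :=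
  ⟨QuantumGraph.hasUnitEnergy_of_isExtremal hG hk hg,
    QuantumGraph.isExtremal_of_hasUnitEnergy hG hk hg⟩
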